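/- **Setting.** Let $F=\mathrm{alg\,lim}\,M_{2^k}(\mathbb C)$ be the algebraic direct limit (a unital complex $*$-algebra) under the unital embeddings $a\mapsto a\oplus a$. For positive integers $n_1,\dots,n_4$ and $r=n_1+\dots+n_4$, the *4-cycle algebra* with block sizes $n_i$ is the algebra of block matrices $(a_{ij})\in M_r$ whose only possibly nonzero blocks are the diagonal ones and those in positions $(1,3),(1,4),(2,3),(2,4)$. Its digraph $D_4$ (vertices $1,2,3,4$, edges these positions) has exactly four symmetries: the identity, the two reflections (exchange of $1,2$; exchange of $3,4$) and their product. A *rigid multiplicity one embedding of type $g$* between 4-cycle algebras, $g$ a symmetry of $D_4$, is the restriction of a map $x\mapsto VxV^*$ with $V$ an isometry carrying the $i$-th block of coordinates into the $g(i)$-th block for each $i$. A *rigid embedding* is an orthogonal direct sum of these; it is *generic* if all four types occur. Each rigid embedding $\alpha$ extends uniquely to a $*$-homomorphism of the generated full matrix algebras. It induces on $H_1=\mathbb Z$, the simplicial homology of the 4-cycle with edges $13,14,23,24$, the sum $H_1(\alpha)$ of the maps induced by the types of its summands. A *generic system* $\mathcal A=\{A_k,\alpha_k\}$ is a sequence of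 4-cycle algebras and rigid embeddings $\alpha_k:A_k\to A_{k+1}$, infinitely many of them generic. Put $A=\mathrm{alg\,lim}A_k$, $B=\mathrm{alg\,lim}\,C^*(A_k)$ (the $*$-algebra generated by $A$) and $H_1(\mathcal A)=\varinjlim(H_1(A_k),H_1(\alpha_k))$. An injective $*$-homomorphism $\pi:D_1\oplus D_2\to D$ of matroid algebras is *given by* $\mathcal A$ if some $*$-isomorphism $B\to D$ carries $A\cap A^*$ onto the range of $\pi$. It is a *generic index 4 inclusion* if it is given by some generic system, and $H_1(\pi)=0$ means that it is given by some generic system $\mathcal A$ with $H_1(\mathcal A)=0$. Two inclusions in $D$ have the *same position* if some $*$-automorphism of $D$ carries the range of one onto the range of the other. The *stationary system* has $A_k=A(D_4)\otimes M_{4^k}$, where $A(D_4)\subset M_4$ is the 4-cycle algebra with all block sizes $1$. Its embeddings $\alpha_k$ are unital and have exactly one summand of each of the four types. Writing elements of $A_k$ with diagonal entries $a,b,c,d$ and off-diagonal entries $x,y,w,z\in M_{4^k}$ in positions $(1,3),(1,4),(2,3),(2,4)$, the image under $\alpha_k$ is the $16\times16$ block matrix with diagonal $(a,a,b,b,a,a,b,b,c,c,d,d,c,c,d,d)$,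 with $x$ in positions $(1,9),(2,13),(5,14),(6,10)$, $y$ in $(1,16),(2,12),(5,11),(6,15)$, $w$ in $(3,14),(4,10),(7,9),(8,13)$, $z$ in $(3,11),(4,15),(7,16),(8,12)$, and zeros elsewhere. **Theorem 4.4.** Up to position there is exactly one generic index 4 inclusion $\zeta:F\oplus F\to F$ with $H_1(\zeta)=0$. More precisely, there is a unital injective $*$-homomorphism $\zeta:F\oplus F\to F$ given by the stationary system; it is a generic index 4 inclusion, the limit homology of the stationary system is zero (so $H_1(\zeta)=0$), and every generic index 4 inclusion $\pi:F\oplus F\to F$ with $H_1(\pi)=0$ has the same position as $\zeta$. -/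

import Mathlib

open scoped Matrix

noncomputable section

namespace FourCycle

/-! ### The dyadic matroid algebra `F = alg lim M_{2^k}` -/

/-- Block-diagonal repetition `a ↦ a ⊕ a ⊕ ⋯ ⊕ a`, as a function on matrices. -/
def repeatBlock (k l : ℕ) (a : Matrix (Fin (2 ^ k)) (Fin (2 ^ k)) ℂ) :
    Matrix (Fin (2 ^ l)) (Fin (2 ^ l)) ℂ :=
  Matrix.of fun i j =>
    if (i : ℕ) / 2 ^ k = (j : ℕ) / 2 ^ k then
      a ⟨(i : ℕ) % 2 ^ k, Nat.mod_lt _ (by positivity)⟩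
        ⟨(j : ℕ) % 2 ^ k, Nat.mod_lt _ (by positivity)⟩
    else 0

theorem repeatBlock_mul (k l : ℕ) (h : k ≤ l) (a b : Matrix (Fin (2 ^ k)) (Fin (2 ^ k)) ℂ) :
    repeatBlock k l (a * b) = repeatBlock k l a * repeatBlock k l b := by
  have hK : 0 < 2 ^ k := by positivity
  ext i j
  simp only [repeatBlock, Matrix.mul_apply, Matrix.of_apply]
  split_ifs with hij
  · symm
    rw [← Finset.sum_filter_add_sum_filter_not Finset.univ
      (fun z : Fin (2 ^ l) => (i : ℕ) / 2 ^ k = (z : ℕ) / 2 ^ k)]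
    rw [Finset.sum_eq_zero (s := Finset.filter (fun z : Fin (2 ^ l) =>
      ¬ (i : ℕ) / 2 ^ k = (z : ℕ) / 2 ^ k) Finset.univ), add_zero]
    · have hlt : ∀ w : Fin (2 ^ k), (i : ℕ) / 2 ^ k * 2 ^ k + w < 2 ^ l := by
        intro w
        have hi : (i : ℕ) / 2 ^ k < 2 ^ (l - k) := by
          rw [Nat.div_lt_iff_lt_mul hK, ← pow_add, Nat.sub_add_cancel h]
          exact i.2
        calc (i : ℕ) / 2 ^ k * 2 ^ k + w < ((i : ℕ) / 2 ^ k + 1) * 2 ^ k := by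
              rw [add_mul, one_mul]; exact Nat.add_lt_add_left w.2 _
          _ ≤ 2 ^ (l - k) * 2 ^ k := Nat.mul_le_mul_right _ hi
          _ = 2 ^ l := by rw [← pow_add, Nat.sub_add_cancel h]
      refine Finset.sum_bij'
        (fun z _ => (⟨(z : ℕ) % 2 ^ k, Nat.mod_lt _ hK⟩ : Fin (2 ^ k)))
        (fun w _ => (⟨(i : ℕ) / 2 ^ k * 2 ^ k + w, hlt w⟩ : Fin (2 ^ l))) ?_ ?_ ?_ ?_ ?_
      · intros; simp
      · intro w _
        simp only [Finset.mem_filter, Finset.mem_univ, true_and]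
        rw [mul_comm, Nat.mul_add_div hK, Nat.div_eq_of_lt w.2, add_zero]
      · intro z hz
        simp only [Finset.mem_filter, Finset.mem_univ, true_and] at hz
        ext
        simp only [hz]
        exact Nat.div_add_mod' _ _
      · intro w _
        ext
        simp only
        rw [mul_comm, Nat.mul_add_mod, Nat.mod_eq_of_lt w.2]
      · intro z hz
        simp only [Finset.mem_filter, Finset.mem_univ, true_and] at hz
        rw [if_pos hz, if_pos (hz.symm.trans hij)]
    · intro z hz
      simp only [Finset.mem_filter, Finset.mem_univ, true_and] at hz
      rw [if_neg hz, zero_mul]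
  · symm
    refine Finset.sum_eq_zero fun z _ => ?_
    by_cases hz : (i : ℕ) / 2 ^ k = (z : ℕ) / 2 ^ k
    · rw [if_neg (fun h' => hij (hz.trans h')), mul_zero]
    · rw [if_neg hz, zero_mul]

theorem repeatBlock_scalar (k l : ℕ) (r : ℂ) :
    repeatBlock k l (Matrix.scalar (Fin (2 ^ k)) r) = Matrix.scalar (Fin (2 ^ l)) r := by
  ext i j
  simp only [repeatBlock, Matrix.of_apply, Matrix.scalar_apply, Matrix.diagonal_apply, Fin.mk.injEq]
  by_cases hij : i = j
  · simp [hij]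
  · rw [if_neg hij]
    split_ifs with h1 h2
    · exact absurd (Fin.ext (by rw [← Nat.div_add_mod (i : ℕ) (2 ^ k), h1, h2, Nat.div_add_mod])) hij
    · rfl
    · rfl

/-- The unital embedding `a ↦ a ⊕ a ⊕ ⋯ ⊕ a` (`2 ^ (l - k)` summands) of `M_{2^k}` in `M_{2^l}`. -/
def dyadicMap (k l : ℕ) (h : k ≤ l) :
    Matrix (Fin (2 ^ k)) (Fin (2 ^ k)) ℂ →⋆ₐ[ℂ] Matrix (Fin (2 ^ l)) (Fin (2 ^ l)) ℂ where
  toFun := repeatBlock k l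
  map_one' := by simpa using repeatBlock_scalar k l 1
  map_mul' := repeatBlock_mul k l h
  map_zero' := by
    ext i j; simp [repeatBlock]
  map_add' a b := by
    ext i j; simp only [repeatBlock, Matrix.of_apply, Matrix.add_apply]; split_ifs <;> simp
  commutes' := repeatBlock_scalar k l
  map_star' a := by
    ext i j
    simp only [repeatBlock, Matrix.of_apply, Matrix.star_apply, eq_comm (a := (j : ℕ) / 2 ^ k)]
    split_ifs <;> simp

theorem repeatBlock_self (k : ℕ) (x : Matrix (Fin (2 ^ k)) (Fin (2 ^ k)) ℂ) :
    repeatBlock k k x = x := by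
  ext i j
  simp [repeatBlock, Nat.div_eq_of_lt, Nat.mod_eq_of_lt]

theorem repeatBlock_comp (k l m : ℕ) (h : k ≤ l) (x : Matrix (Fin (2 ^ k)) (Fin (2 ^ k)) ℂ) :
    repeatBlock l m (repeatBlock k l x) = repeatBlock k m x := by
  ext p q
  obtain ⟨c, rfl⟩ := Nat.exists_eq_add_of_le h
  simp only [repeatBlock, Matrix.of_apply, pow_add, Nat.mod_mul_right_div_self,
    Nat.mod_mul_right_mod, ← Nat.div_div_eq_div_mul]
  by_cases hpq : (p : ℕ) / 2 ^ k = (q : ℕ) / 2 ^ k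
  · simp [hpq]
  · rw [if_neg hpq]
    split_ifs with h1 h2
    · exact absurd (by rw [← Nat.div_add_mod ((p : ℕ) / 2 ^ k) (2 ^ c), h1, h2,
        Nat.div_add_mod]) hpq
    · rfl
    · rfl

instance dyadicSystem :
    DirectedSystem (fun k : ℕ => Matrix (Fin (2 ^ k)) (Fin (2 ^ k)) ℂ) (dyadicMap · · ·) where
  map_self k x := repeatBlock_self k x
  map_map _ _ _ hij _ x := repeatBlock_comp _ _ _ hij x

/-- The unital matroid algebra `F = alg lim M_{2^k}(ℂ)`, a complex unital `*`-algebra. -/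
abbrev DyadicMatroid : Type :=
  DirectLimit (fun k : ℕ => Matrix (Fin (2 ^ k)) (Fin (2 ^ k)) ℂ) dyadicMap

/-! ### The 4-cycle digraph and 4-cycle algebras

The four vertices (blocks) `1, 2, 3, 4` are written `0, 1, 2, 3 : Fin 4`. -/

/-- The digraph `D₄` of the 4-cycle algebra `A(D₄)`: all loops, and `(i, j)` with `i ∈ {1, 2}` and
`j ∈ {3, 4}`. The matrix unit `e_{ij}` lies in `A(D₄)` exactly when `D4 i j`. -/
def D4 (i j : Fin 4) : Prop := i = j ∨ ((i : ℕ) < 2 ∧ 2 ≤ (j : ℕ))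

instance : DecidableRel D4 := fun _ _ => by unfold D4; infer_instance

/-- The symmetries of the digraph `D₄`. -/
abbrev D4Symmetry : Type := D4 ≃r D4

/-- The index set of `M_r`, `r = n₁ + n₂ + n₃ + n₄`, partitioned into four blocks. -/
abbrev Idx (n : Fin 4 → ℕ) : Type := Σ i : Fin 4, Fin (n i)

/-- The full matrix algebra `M_r`, `r = n₁ + n₂ + n₃ + n₄`. For positive `n i`
it is the `*`-algebra generated by the 4-cycle algebra with block sizes `n`. -/
abbrev FullMatrix (n : Fin 4 → ℕ) : Type := Matrix (Idx n) (Idx n) ℂ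

/-- The 4-cycle algebra with block sizes `n₁, n₂, n₃, n₄`: the block matrices in `M_r` supported on
the diagonal blocks and on the blocks `(1,3), (1,4), (2,3), (2,4)`. -/
def fourCycleAlgebra (n : Fin 4 → ℕ) : Subalgebra ℂ (FullMatrix n) where
  carrier := {a | ∀ p q : Idx n, ¬ D4 p.1 q.1 → a p q = 0}
  mul_mem' {a b} ha hb p q hpq := by
    rw [Matrix.mul_apply]
    refine Finset.sum_eq_zero fun z _ => ?_
    by_cases h1 : D4 p.1 z.1
    · have h2 : ¬ D4 z.1 q.1 := by
        intro h2
        apply hpq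
        rcases h1 with h1 | h1
        · rwa [h1]
        · rcases h2 with h2 | h2
          · rw [← h2]; exact Or.inr h1
          · exact absurd h1.2 (by omega)
      rw [hb z q h2, mul_zero]
    · rw [ha p z h1, zero_mul]
  add_mem' {a b} ha hb p q hpq := by
    rw [Matrix.add_apply, ha p q hpq, hb p q hpq, add_zero]
  algebraMap_mem' r p q hpq := by
    rw [Matrix.algebraMap_matrix_apply, if_neg]
    rintro rfl
    exact hpq (Or.inl rfl)

/-! ### Rigid and generic embeddings -/

/-- A rigid embedding between the 4-cycle algebras with block sizes `n` and `m`, given together with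
a decomposition `x ↦ ∑ₛ Vₛ x Vₛ*` as an orthogonal direct sum of rigid embeddings
of multiplicity one.

A multiplicity one star extendible embedding has an extension to full matrix algebras of the form
`x ↦ V x V*` with `V` an isometry. It is rigid when it carries the matrix units of the four
off-diagonal blocks into four distinct off-diagonal blocks, that is, when for some symmetry `g`
of `D₄` (its type) `V` maps the `i`-th block of coordinates into the `g i`-th block. As `V` may be
multiplied on the left by any block diagonal unitary, this class of embeddings is
closed under inner unitary equivalence in the range algebra. -/
structure RigidEmbedding (n m : Fin 4 → ℕ) where
  /-- the number of multiplicity one summands -/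
  mult : ℕ
  /-- the symmetry type of each summand -/
  type : Fin mult → D4Symmetry
  /-- the implementing isometries -/
  V : Fin mult → Matrix (Idx m) (Idx n) ℂ
  /-- each `V s` is an isometry -/
  isometry : ∀ s, (V s)ᴴ * V s = (1 : Matrix (Idx n) (Idx n) ℂ)
  /-- the summands are mutually orthogonal -/
  orthogonal : ∀ s t, s ≠ t → (V s)ᴴ * V t = (0 : Matrix (Idx n) (Idx n) ℂ)
  /-- `V s` maps block `i` into block `type s i` -/
  block : ∀ s p q, p.1 ≠ type s q.1 → V s p q = 0

namespace RigidEmbedding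

variable {n m : Fin 4 → ℕ} (φ : RigidEmbedding n m)

/-- The star extension `x ↦ ∑ₛ Vₛ x Vₛ*` to the full matrix algebras. -/
def toStarHom : FullMatrix n →⋆ₙₐ[ℂ] FullMatrix m where
  toFun x := ∑ s, φ.V s * x * (φ.V s)ᴴ
  map_smul' c x := by
    simp only [Matrix.mul_smul, Matrix.smul_mul, Finset.smul_sum, MonoidHom.id_apply]
  map_zero' := by simp
  map_add' x y := by
    simp only [Matrix.mul_add, Matrix.add_mul, Finset.sum_add_distrib]
  map_mul' x y := by
    rw [Finset.sum_mul_sum]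
    refine Finset.sum_congr rfl fun s _ => ?_
    rw [Finset.sum_eq_single s]
    · have h : φ.V s * x * (φ.V s)ᴴ * (φ.V s * y * (φ.V s)ᴴ)
          = φ.V s * x * ((φ.V s)ᴴ * φ.V s) * (y * (φ.V s)ᴴ) := by simp only [Matrix.mul_assoc]
      rw [h, φ.isometry s]
      simp only [Matrix.mul_assoc, Matrix.one_mul]
    · intro t _ hts
      have h : φ.V s * x * (φ.V s)ᴴ * (φ.V t * y * (φ.V t)ᴴ)
          = φ.V s * x * ((φ.V s)ᴴ * φ.V t) * (y * (φ.V t)ᴴ) := by simp only [Matrix.mul_assoc]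
      rw [h, φ.orthogonal s t hts.symm, Matrix.mul_zero, Matrix.zero_mul]
    · simp
  map_star' x := by
    simp [Matrix.star_eq_conjTranspose, Matrix.mul_assoc]

/-- A rigid embedding is generic if each of the four types occurs among its summands. -/
def IsGeneric : Prop := Function.Surjective φ.type

end RigidEmbedding

/-! ### Simplicial homology of the 4-cycle

The simplicial complex of (the reduced digraph of) any 4-cycle algebra has the vertices `1, 2, 3, 4`
and the edges `13, 14, 23, 24`. It has no 2-simplices, so `H₁` is the group of 1-cycles. -/

/-- The edges (1-simplices) of the complex of `D₄`. -/
abbrev Edge : Type := {e : Fin 4 × Fin 4 // e.1 ≠ e.2 ∧ D4 e.1 e.2}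

/-- No three vertices of `D₄` are pairwise adjacent, so the complex has no 2-simplices. -/
theorem no_triangles (i j k : Fin 4) (hij : D4 i j ∨ D4 j i) (hjk : D4 j k ∨ D4 k j)
    (hik : D4 i k ∨ D4 k i) : i = j ∨ j = k ∨ i = k := by
  revert i j k; decide

/-- The boundary map `C₁ → C₀`. -/
def boundary : (Edge →₀ ℤ) →ₗ[ℤ] (Fin 4 →₀ ℤ) :=
  Finsupp.linearCombination ℤ fun e : Edge =>
    Finsupp.single e.1.2 (1 : ℤ) - Finsupp.single e.1.1 (1 : ℤ)

/-- The integral simplicial homology group `H₁` of a 4-cycle algebra. -/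
abbrev H1 : Type := LinearMap.ker boundary

/-- The action of a symmetry of `D₄` on edges. -/
def edgeMap (g : D4Symmetry) (e : Edge) : Edge :=
  ⟨(g e.1.1, g e.1.2), fun h => e.2.1 (g.injective h), g.map_rel_iff.2 e.2.2⟩

theorem boundary_edgeMap (g : D4Symmetry) (c : Edge →₀ ℤ) :
    boundary (Finsupp.lmapDomain ℤ ℤ (edgeMap g) c) =
      Finsupp.lmapDomain ℤ ℤ g (boundary c) := by
  induction c using Finsupp.induction_linear with
  | zero => simp
  | add a b ha hb => simp only [map_add, ha, hb]
  | single e z =>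
    simp [boundary, edgeMap, Finsupp.mapDomain_single, Finsupp.mapDomain_sub, smul_sub]

/-- The map on `H₁` induced by a symmetry of `D₄`. -/
def homologyOfSymmetry (g : D4Symmetry) : H1 →ₗ[ℤ] H1 :=
  (Finsupp.lmapDomain ℤ ℤ (edgeMap g)).restrict fun c hc => by
    rw [LinearMap.mem_ker] at hc ⊢
    rw [boundary_edgeMap, hc, map_zero]

/-- The map on `H₁` induced by a rigid embedding: the sum of the maps induced by its multiplicity
one summands. -/
def RigidEmbedding.homology {n m : Fin 4 → ℕ} (φ : RigidEmbedding n m) : H1 →ₗ[ℤ] H1 :=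
  ∑ s, homologyOfSymmetry (φ.type s)

/-! ### Direct systems of 4-cycle algebras -/

/-- A direct system of 4-cycle algebras with rigid embeddings. -/
structure RigidSystem where
  /-- block sizes of the algebras `A_k` -/
  dim : ℕ → Fin 4 → ℕ
  dim_pos : ∀ k i, 0 < dim k i
  /-- the embeddings `α_k : A_k → A_{k+1}` -/
  emb : ∀ k, RigidEmbedding (dim k) (dim (k + 1))

namespace RigidSystem

variable (S : RigidSystem)

/-- The system is generic if infinitely many of its embeddings are. -/
def IsGeneric : Prop := ∀ N, ∃ k, N ≤ k ∧ (S.emb k).IsGeneric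

/-- The composite map `H₁(A_k) → H₁(A_l)`, `k ≤ l`. -/
def homologyMap (k l : ℕ) (h : k ≤ l) : H1 →ₗ[ℤ] H1 :=
  Nat.leRecOn (C := fun _ => H1 →ₗ[ℤ] H1) h (fun {j} f => (S.emb j).homology ∘ₗ f) LinearMap.id

/-- The limit homology group `H₁({A_k, α_k}) = lim (H₁(A_k), H₁(α_k))`. -/
abbrev LimitH1 : Type := Module.DirectLimit (R := ℤ) (fun _ : ℕ => H1) S.homologyMap

/-- A realisation of a `*`-algebra `B` as the algebraic direct limit of the full matrix algebras
`C*(A_k)` with respect to the star extensions of the `α_k`: compatible injective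
`*`-homomorphisms `C*(A_k) → B` whose ranges exhaust `B`. -/
structure Realization (B : Type*) [NonUnitalRing B] [StarRing B] [Module ℂ B] where
  incl : ∀ k, FullMatrix (S.dim k) →⋆ₙₐ[ℂ] B
  injective : ∀ k, Function.Injective (incl k)
  compatible : ∀ k x, incl (k + 1) ((S.emb k).toStarHom x) = incl k x
  exhausts : ∀ b, ∃ k x, incl k x = b

namespace Realization

variable {S} {B : Type*} [NonUnitalRing B] [StarRing B] [Module ℂ B] (ι : S.Realization B)

/-- The limit algebra `A = alg lim (A_k, α_k)` inside the `*`-algebra `B` that it generates. -/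
def limitAlgebra : Set B := {b | ∃ k, ∃ x ∈ fourCycleAlgebra (S.dim k), ι.incl k x = b}

/-- The self-adjoint part `A ∩ A*` of the limit algebra. -/
def selfAdjointPart : Set B := {b | b ∈ ι.limitAlgebra ∧ star b ∈ ι.limitAlgebra}

end Realization

end RigidSystem

/-! ### Inclusions and their positions -/

section Inclusions

variable {D₁ D₂ B : Type*}
  [NonUnitalRing D₁] [StarRing D₁] [Module ℂ D₁]
  [NonUnitalRing D₂] [StarRing D₂] [Module ℂ D₂]
  [NonUnitalRing B] [StarRing B] [Module ℂ B]

/-- The inclusion `π : D₁ ⊕ D₂ → B` is given by the system `S`: up to a star isomorphism, `B` is the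
`*`-algebra generated by the limit algebra `A` of `S`, and `π` has range `A ∩ A*`. (As the
realisation of `B` is arbitrary, it absorbs conjugation by star automorphisms of `B`.) -/
def IsGivenBy (π : D₁ × D₂ →⋆ₙₐ[ℂ] B) (S : RigidSystem) : Prop :=
  Function.Injective π ∧ ∃ ι : S.Realization B, Set.range π = ι.selfAdjointPart

/-- An inclusion `π : D₁ ⊕ D₂ → B` (of matroid algebras) is a generic index 4 inclusion if it is
given by a generic system of 4-cycle algebras. -/
def IsGenericIndexFour (π : D₁ × D₂ →⋆ₙₐ[ℂ] B) : Prop :=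
  ∃ S : RigidSystem, S.IsGeneric ∧ IsGivenBy π S

/-- `H₁(π) = 0`: the inclusion `π` is given by a generic system whose limit homology is zero. -/
def HasTrivialHomology (π : D₁ × D₂ →⋆ₙₐ[ℂ] B) : Prop :=
  ∃ S : RigidSystem, S.IsGeneric ∧ IsGivenBy π S ∧ Subsingleton S.LimitH1

/-- Two inclusions have the same position if their ranges are conjugate by a star
automorphism of `B`. -/
def SamePosition (π π' : D₁ × D₂ →⋆ₙₐ[ℂ] B) : Prop :=
  ∃ σ : B ≃⋆ₐ[ℂ] B, σ '' Set.range π = Set.range π'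

end Inclusions

/-! ### The stationary system based on the simplest generic embeddings -/

/-- The reflection of `D₄` exchanging the vertices `1` and `2`. -/
def swap12 : D4Symmetry := ⟨Equiv.swap 0 1, by decide⟩

/-- The reflection of `D₄` exchanging the vertices `3` and `4`. -/
def swap34 : D4Symmetry := ⟨Equiv.swap 2 3, by decide⟩

/-- The four symmetries of `D₄`, in the order: identity, exchange of `3, 4`, exchange of `1, 2`,
rotation (both exchanges). -/
def symmetry : Fin 4 → D4Symmetry :=
  ![RelIso.refl D4, swap34, swap12, swap12.trans swap34]

/-- `position s i` is the place, among the four sub-blocks of size `4^k` of block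
`symmetry s i` of `M_{4^{k+1}} ⊗ M_4`, taken by the copy of block `i` in the `s`-th summand. With
block rows and columns `1, …, 16`, the block rows for blocks `1, 2` and the block columns for blocks
`3, 4` are: `1, 7; 9, 16` for the identity, `2, 8; 13, 12` for the exchange of `3, 4`,
`6, 4; 10, 15` for the exchange of `1, 2`, and `5, 3; 14, 11` for the rotation. -/
def position : Fin 4 → Fin 4 → Fin 4 :=
  ![![0, 2, 0, 3], ![1, 3, 0, 3], ![1, 3, 1, 2], ![0, 2, 1, 2]]

/-- The isometry implementing the `s`-th summand of the `k`-th stationary embedding. -/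
def stationaryV (k : ℕ) (s : Fin 4) :
    Matrix (Idx fun _ => 4 ^ (k + 1)) (Idx fun _ => 4 ^ k) ℂ :=
  Matrix.of fun p q =>
    if p.1 = symmetry s q.1 ∧ (p.2 : ℕ) = position s q.1 * 4 ^ k + q.2 then 1 else 0

theorem position_injective : ∀ s t i j : Fin 4, symmetry s i = symmetry t j →
    position s i = position t j → s = t ∧ i = j := by
  decide

theorem stationaryV_mul (k : ℕ) (s t : Fin 4) :
    (stationaryV k s)ᴴ * stationaryV k t = if s = t then 1 else 0 := by
  have hK : 0 < 4 ^ k := by positivity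
  have hlt : ∀ (c : Fin 4) (r : Fin (4 ^ k)), (c : ℕ) * 4 ^ k + r < 4 ^ (k + 1) := by
    intro c r
    have h1 : ((c : ℕ) + 1) * 4 ^ k ≤ 4 * 4 ^ k := Nat.mul_le_mul_right _ c.2
    have h2 := r.2
    rw [pow_succ]
    linarith [add_mul (c : ℕ) 1 (4 ^ k)]
  ext p q
  rw [Matrix.mul_apply]
  rw [Finset.sum_eq_single (⟨symmetry s p.1, ⟨_, hlt (position s p.1) p.2⟩⟩ :
    Idx fun _ => 4 ^ (k + 1))]
  · simp only [stationaryV, Matrix.conjTranspose_apply, Matrix.of_apply, and_self, if_true,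
      star_one, one_mul]
    by_cases h : s = t ∧ p = q
    · obtain ⟨rfl, rfl⟩ := h
      simp
    · rw [if_neg]
      · split_ifs with hst
        · rw [Matrix.one_apply_ne fun hpq => h ⟨hst, hpq⟩]
        · rfl
      · rintro ⟨h1, h2⟩
        have h3 : position s p.1 = position t q.1 := by
          have := congrArg (· / 4 ^ k) h2
          simp only [mul_comm _ (4 ^ k), Nat.mul_add_div hK, Nat.div_eq_of_lt p.2.2,
            Nat.div_eq_of_lt q.2.2, add_zero] at this
          exact Fin.ext this
        obtain ⟨rfl, h4⟩ := position_injective s t p.1 q.1 h1 h3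
        refine h ⟨rfl, ?_⟩
        obtain ⟨i, r⟩ := p
        obtain ⟨j, r'⟩ := q
        obtain rfl : i = j := h4
        simp only [add_right_inj] at h2
        rw [Fin.ext h2]
  · intro z _ hz
    rw [Matrix.conjTranspose_apply, stationaryV, Matrix.of_apply, if_neg, star_zero, zero_mul]
    rintro ⟨h1, h2⟩
    apply hz
    obtain ⟨j, r⟩ := z
    obtain rfl : j = _ := h1
    congr 1
    exact Fin.ext h2
  · simp

/-- The generic embedding `A(D₄) ⊗ M_{4^k} → A(D₄) ⊗ M_{4^{k+1}}` with one summand of each type. -/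
def stationaryEmbedding (k : ℕ) : RigidEmbedding (fun _ => 4 ^ k) (fun _ => 4 ^ (k + 1)) where
  mult := 4
  type := symmetry
  V := stationaryV k
  isometry s := by rw [stationaryV_mul, if_pos rfl]
  orthogonal s t h := by rw [stationaryV_mul, if_neg h]
  block s p q h := by
    simp only [stationaryV, Matrix.of_apply]
    exact if_neg fun h' => h h'.1

/-- The stationary system `A_k = A(D₄) ⊗ M_{4^k}`. -/
def stationarySystem : RigidSystem where
  dim k _ := 4 ^ k
  dim_pos k _ := by positivity
  emb := stationaryEmbedding

end FourCycle

end

noncomputable section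

namespace FourCycle

/-! ### Symmetries of the 4-cycle digraph -/

/-! The symmetries of the digraph form the Klein four group, whose nontrivial characters are
`moveSign 0`, `moveSign 2` and their product `cycleSign`. Summing a character over the types of the
summands of a rigid embedding gives a number, `charSum`, which is multiplicative under composition.
Together with the multiplicity, the three sums determine how often each type occurs. If all three
vanish, the four types occur equally often (`IsBalanced`). In a system where each character vanishes
infinitely often, every long enough composite is therefore balanced.

Each vanishing has its own source. The character `cycleSign` is the action on `H₁ = ℤ`, so zero
limit homology means precisely that it vanishes infinitely often (`subsingleton_limitH1_iff`). The
vertex characters are forced by `A ∩ A*` being a copy of `F ⊕ F`: the corner at one side of the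
cycle is then a copy of `F`, whose matrix algebras carry one trace up to scale, whereas each side
has two block traces (`moveSign_and_dim`). The same traces show that the sizes are powers of two.

For uniqueness, unital rigid embeddings with the same types differ by a block diagonal unitary
(`exists_unitary`), and for balanced ones the sizes determine the types. Two such systems can thus
be intertwined (`exists_extension`), and the limit isomorphism matches the self-adjoint parts
(`exists_starEquiv`). For existence, suitable coordinates turn the stationary embeddings into `a ↦ a
⊕ a ⊕ a ⊕ a`, on the full matrix algebras and on each side of the self-adjoint part. -/

/-- The other vertex on the same side of the 4-cycle. -/
def mate : Fin 4 → Fin 4 := ![1, 0, 3, 2]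

theorem mate_ne (i : Fin 4) : mate i ≠ i := by revert i; decide

theorem mate_mate (i : Fin 4) : mate (mate i) = i := by revert i; decide

/-- The vertices `0, 1` are exactly those with an outgoing edge other than the loop, so no symmetry
moves them to the other side. -/
theorem symmetry_lt_two_iff (g : D4Symmetry) (i : Fin 4) : (g i : ℕ) < 2 ↔ (i : ℕ) < 2 := by
  constructor
  · intro h
    by_contra hi
    have h1 : D4 (g 0) (g i) := g.map_rel_iff.2 (Or.inr ⟨by simp, by omega⟩)
    rcases h1 with h1 | h1
    · have := g.injective h1
      subst this
      simp at hi
    · omega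
  · intro h
    have h1 : D4 (g i) (g 2) := g.map_rel_iff.2 (Or.inr ⟨h, by simp⟩)
    rcases h1 with h1 | h1
    · have := g.injective h1
      subst this
      simp at h
    · exact h1.1

theorem symmetry_apply_eq_or (g : D4Symmetry) (i : Fin 4) : g i = i ∨ g i = mate i := by
  have h := symmetry_lt_two_iff g i
  generalize g i = j at h
  revert i j
  decide

theorem symmetry_mate (g : D4Symmetry) (i : Fin 4) : g (mate i) = mate (g i) := by
  rcases symmetry_apply_eq_or g i with h | h <;> rcases symmetry_apply_eq_or g (mate i) with h' | h'
  · rw [h, h']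
  · rw [mate_mate] at h'
    exact absurd (g.injective (h'.trans h.symm)) (mate_ne i)
  · exact absurd (g.injective (h'.trans h.symm)) (mate_ne i)
  · rw [h, h']

/-- The character of the symmetry group of `D₄` recording whether the vertex `i` is moved. -/
def moveSign (i : Fin 4) (g : D4Symmetry) : ℤ := if g i = i then 1 else -1

theorem moveSign_eq_or (i : Fin 4) (g : D4Symmetry) : moveSign i g = 1 ∨ moveSign i g = -1 := by
  unfold moveSign; split_ifs <;> simp

theorem moveSign_trans (i : Fin 4) (g h : D4Symmetry) :
    moveSign i (g.trans h) = moveSign i g * moveSign i h := by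
  have hm := mate_ne i
  have hmm := mate_mate i
  simp only [moveSign, RelIso.trans_apply]
  rcases symmetry_apply_eq_or g i with h1 | h1 <;> rcases symmetry_apply_eq_or h i with h2 | h2 <;>
    simp [h1, h2, hm, symmetry_mate, hmm]

/-- Commutation with `mate` lets the images of `0` and `2` determine those of `1` and `3`, so the
symmetry group embeds in `{±1}²`. -/
theorem symmetry_ext {g h : D4Symmetry} (h0 : moveSign 0 g = moveSign 0 h)
    (h2 : moveSign 2 g = moveSign 2 h) : g = h := by
  have key : ∀ i, moveSign i g = moveSign i h → g i = h i := by
    intro i hi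
    have hm := mate_ne i
    rcases symmetry_apply_eq_or g i with h1 | h1 <;>
      rcases symmetry_apply_eq_or h i with h2 | h2 <;>
      simp_all [moveSign]
  have k0 := key 0 h0
  have k2 := key 2 h2
  have k1 : g 1 = h 1 := by
    have := congrArg mate k0
    rwa [← symmetry_mate, ← symmetry_mate] at this
  have k3 : g 3 = h 3 := by
    have := congrArg mate k2
    rwa [← symmetry_mate, ← symmetry_mate] at this
  ext i
  fin_cases i
  · exact congrArg Fin.val k0
  · exact congrArg Fin.val k1
  · exact congrArg Fin.val k2
  · exact congrArg Fin.val k3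

theorem moveSign_symmetry (s : Fin 4) :
    moveSign 0 (symmetry s) = ![1, 1, -1, -1] s ∧ moveSign 2 (symmetry s) = ![1, -1, 1, -1] s := by
  revert s; decide

theorem symmetry_surjective : Function.Surjective symmetry := by
  intro g
  rcases moveSign_eq_or 0 g with h0 | h0 <;> rcases moveSign_eq_or 2 g with h2 | h2
  · exact ⟨0, symmetry_ext (by rw [h0, (moveSign_symmetry 0).1]; rfl)
      (by rw [h2, (moveSign_symmetry 0).2]; rfl)⟩
  · exact ⟨1, symmetry_ext (by rw [h0, (moveSign_symmetry 1).1]; rfl)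
      (by rw [h2, (moveSign_symmetry 1).2]; rfl)⟩
  · exact ⟨2, symmetry_ext (by rw [h0, (moveSign_symmetry 2).1]; rfl)
      (by rw [h2, (moveSign_symmetry 2).2]; rfl)⟩
  · exact ⟨3, symmetry_ext (by rw [h0, (moveSign_symmetry 3).1]; rfl)
      (by rw [h2, (moveSign_symmetry 3).2]; rfl)⟩

theorem symmetry_injective : Function.Injective symmetry := by
  intro s t h
  have h0 := congrArg (moveSign 0) h
  have h2 := congrArg (moveSign 2) h
  rw [(moveSign_symmetry s).1, (moveSign_symmetry t).1] at h0
  rw [(moveSign_symmetry s).2, (moveSign_symmetry t).2] at h2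
  revert s t; decide

/-- The product of the two vertex characters: the action on the homology of the 4-cycle. -/
def cycleSign (g : D4Symmetry) : ℤ := moveSign 0 g * moveSign 2 g

theorem cycleSign_trans (g h : D4Symmetry) :
    cycleSign (g.trans h) = cycleSign g * cycleSign h := by
  simp only [cycleSign, moveSign_trans]; ring

open Classical in
-- Orthogonality of characters: the right side factors as `(1 + moveSign 0 g * moveSign 0 h) * (1 +
-- moveSign 2 g * moveSign 2 h)`.
theorem four_mul_indicator (g h : D4Symmetry) :
    (4 * if h = g then 1 else 0 : ℤ) = 1 + moveSign 0 g * moveSign 0 h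
      + moveSign 2 g * moveSign 2 h + cycleSign g * cycleSign h := by
  unfold cycleSign
  split_ifs with hgh
  · subst hgh
    rcases moveSign_eq_or 0 h with h0 | h0 <;> rcases moveSign_eq_or 2 h with h2 | h2 <;>
      rw [h0, h2] <;> norm_num
  · have : ¬ (moveSign 0 h = moveSign 0 g ∧ moveSign 2 h = moveSign 2 g) :=
      fun hc => hgh (symmetry_ext hc.1 hc.2)
    rcases moveSign_eq_or 0 h with h0 | h0 <;> rcases moveSign_eq_or 2 h with h2 | h2 <;>
    rcases moveSign_eq_or 0 g with k0 | k0 <;> rcases moveSign_eq_or 2 g with k2 | k2 <;>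
      rw [h0, h2, k0, k2] at this <;> rw [h0, h2, k0, k2] <;> simp at this <;> norm_num

/-! ### Block traces -/

/-- The projection onto the `j`-th block of coordinates. -/
def blockProj (n : Fin 4 → ℕ) (j : Fin 4) : FullMatrix n :=
  Matrix.diagonal fun p => if p.1 = j then 1 else 0

/-- The trace of the `j`-th diagonal block. -/
def blockTrace {n : Fin 4 → ℕ} (j : Fin 4) (x : FullMatrix n) : ℂ :=
  Matrix.trace (blockProj n j * x)

variable {n m l : Fin 4 → ℕ}

theorem blockTrace_eq_sum (j : Fin 4) (x : FullMatrix n) :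
    blockTrace j x = ∑ p, if p.1 = j then x p p else 0 := by
  simp [blockTrace, blockProj, Matrix.trace, Matrix.diagonal_mul]

theorem blockTrace_one (j : Fin 4) : blockTrace j (1 : FullMatrix n) = n j := by
  rw [blockTrace_eq_sum, Fintype.sum_sigma, Finset.sum_eq_single j] <;> simp +contextual

theorem blockTrace_single (j : Fin 4) (p : Idx n) :
    blockTrace j (Matrix.single p p 1 : FullMatrix n) = if p.1 = j then 1 else 0 := by
  rw [blockTrace_eq_sum, Finset.sum_eq_single p]
  · simp
  · intro q _ hq
    simp [Ne.symm hq]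
  · simp

theorem blockTrace_blockProj (i j : Fin 4) :
    blockTrace j (blockProj n i) = if i = j then (n j : ℂ) else 0 := by
  rw [blockTrace_eq_sum]
  simp only [blockProj, Matrix.diagonal_apply_eq, Fintype.sum_sigma]
  split_ifs with h
  · subst h
    rw [Finset.sum_eq_single i] <;> simp +contextual
  · refine Finset.sum_eq_zero fun a _ => Finset.sum_eq_zero fun b _ => ?_
    split_ifs with h1 h2
    · exact absurd (h2.symm.trans h1) h
    · rfl
    · rfl

theorem blockTrace_add (j : Fin 4) (x y : FullMatrix n) :
    blockTrace j (x + y) = blockTrace j x + blockTrace j y := by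
  rw [blockTrace, mul_add, Matrix.trace_add]; rfl

theorem blockTrace_smul (j : Fin 4) (c : ℂ) (x : FullMatrix n) :
    blockTrace j (c • x) = c * blockTrace j x := by
  rw [blockTrace, Matrix.mul_smul, Matrix.trace_smul]; rfl

/-- A matrix is block diagonal for the partition of the coordinates into four blocks. -/
def IsBlockDiagonal (x : FullMatrix n) : Prop := ∀ p q, p.1 ≠ q.1 → x p q = 0

theorem isBlockDiagonal_blockProj (j : Fin 4) : IsBlockDiagonal (blockProj n j) := by
  intro p q hpq
  rw [blockProj, Matrix.diagonal_apply_ne]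
  rintro rfl; exact hpq rfl

theorem isBlockDiagonal_one : IsBlockDiagonal (1 : FullMatrix n) := by
  intro p q hpq
  rw [Matrix.one_apply_ne]
  rintro rfl; exact hpq rfl

theorem IsBlockDiagonal.add {x y : FullMatrix n} (hx : IsBlockDiagonal x) (hy : IsBlockDiagonal y) :
    IsBlockDiagonal (x + y) := by
  intro p q h
  rw [Matrix.add_apply, hx p q h, hy p q h, add_zero]

theorem IsBlockDiagonal.mul_blockProj {x : FullMatrix n} (hx : IsBlockDiagonal x) (j : Fin 4) :
    x * blockProj n j = blockProj n j * x := by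
  ext p q
  rw [blockProj, Matrix.mul_diagonal, Matrix.diagonal_mul]
  by_cases h : p.1 = q.1
  · rw [h, mul_comm]
  · rw [hx p q h]; simp

/-- `x` commutes with the block projections. Each block trace is therefore tracial on block diagonal
matrices, which gives two independent traces on each side of the cycle. -/
theorem IsBlockDiagonal.blockTrace_mul_comm {x y : FullMatrix n} (hx : IsBlockDiagonal x)
    (j : Fin 4) : blockTrace j (x * y) = blockTrace j (y * x) := by
  rw [blockTrace, blockTrace, ← mul_assoc, ← hx.mul_blockProj, mul_assoc, Matrix.trace_mul_comm,
    mul_assoc]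

/-- Off the diagonal `D4` is antisymmetric, so an off-diagonal block and its transpose are never
both allowed. -/
theorem mem_fourCycle_and_star_iff (x : FullMatrix n) :
    (x ∈ fourCycleAlgebra n ∧ star x ∈ fourCycleAlgebra n) ↔ IsBlockDiagonal x := by
  constructor
  · rintro ⟨h1, h2⟩ p q hpq
    by_cases h : D4 p.1 q.1
    · have h3 : ¬ D4 q.1 p.1 := by
        rintro (h4 | h4)
        · exact hpq h4.symm
        · rcases h with h | h
          · exact hpq h
          · omega
      have := h2 q p h3
      rwa [Matrix.star_apply, star_eq_zero] at this
    · exact h1 p q h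
  · intro h
    refine ⟨fun p q hpq => h p q fun h' => hpq (Or.inl h'), fun p q hpq => ?_⟩
    rw [Matrix.star_apply, h q p fun h' => hpq (Or.inl h'.symm), star_zero]

/-! ### Rigid embeddings -/

namespace RigidEmbedding

theorem toStarHom_apply (φ : RigidEmbedding n m) (x : FullMatrix n) :
    φ.toStarHom x = ∑ s, φ.V s * x * (φ.V s)ᴴ := rfl

/-- A rigid embedding is unital if its star extension is. -/
def IsUnital (φ : RigidEmbedding n m) : Prop := φ.toStarHom 1 = 1

theorem isUnital_iff (φ : RigidEmbedding n m) :
    φ.IsUnital ↔ ∑ s, φ.V s * (φ.V s)ᴴ = 1 := by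
  simp [IsUnital, toStarHom_apply]

/-- The identity embedding. -/
def refl (n : Fin 4 → ℕ) : RigidEmbedding n n where
  mult := 1
  type _ := RelIso.refl D4
  V _ := 1
  isometry _ := by simp
  orthogonal s t h := absurd (Subsingleton.elim s t) h
  block s p q h := Matrix.one_apply_ne fun h' => h (by rw [h']; rfl)

@[simp] theorem refl_toStarHom (x : FullMatrix n) : (refl n).toStarHom x = x := by
  rw [toStarHom_apply]
  change ∑ s : Fin 1, (1 : FullMatrix n) * x * (1 : FullMatrix n)ᴴ = x
  simp

theorem refl_isUnital : (refl n).IsUnital := refl_toStarHom 1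

/-- The composite of two rigid embeddings. -/
def comp (ψ : RigidEmbedding m l) (φ : RigidEmbedding n m) : RigidEmbedding n l where
  mult := φ.mult * ψ.mult
  type s := (φ.type (finProdFinEquiv.symm s).1).trans (ψ.type (finProdFinEquiv.symm s).2)
  V s := ψ.V (finProdFinEquiv.symm s).2 * φ.V (finProdFinEquiv.symm s).1
  isometry s := by
    rw [Matrix.conjTranspose_mul, Matrix.mul_assoc, ← Matrix.mul_assoc _ (ψ.V _), ψ.isometry,
      Matrix.one_mul, φ.isometry]
  orthogonal s t h := by
    rw [Matrix.conjTranspose_mul, Matrix.mul_assoc, ← Matrix.mul_assoc _ (ψ.V _)]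
    by_cases h2 : (finProdFinEquiv.symm s).2 = (finProdFinEquiv.symm t).2
    · rw [h2, ψ.isometry, Matrix.one_mul, φ.orthogonal]
      intro h1
      exact h (finProdFinEquiv.symm.injective (Prod.ext h1 h2))
    · rw [ψ.orthogonal _ _ h2, Matrix.zero_mul, Matrix.mul_zero]
  block s p q h := by
    rw [Matrix.mul_apply]
    refine Finset.sum_eq_zero fun z _ => ?_
    by_cases hz : z.1 = φ.type (finProdFinEquiv.symm s).1 q.1
    · rw [ψ.block _ p z, zero_mul]
      rw [hz]; exact h
    · rw [φ.block _ z q hz, mul_zero]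

theorem sum_comp {M : Type*} [AddCommMonoid M] (ψ : RigidEmbedding m l) (φ : RigidEmbedding n m)
    (f : Fin φ.mult → Fin ψ.mult → M) :
    ∑ s : Fin (ψ.comp φ).mult, f (finProdFinEquiv.symm s).1 (finProdFinEquiv.symm s).2 =
      ∑ a, ∑ b, f a b := by
  rw [← Fintype.sum_prod_type' f]
  exact Fintype.sum_equiv finProdFinEquiv.symm _ _ fun _ => rfl

theorem comp_toStarHom (ψ : RigidEmbedding m l) (φ : RigidEmbedding n m) (x : FullMatrix n) :
    (ψ.comp φ).toStarHom x = ψ.toStarHom (φ.toStarHom x) := by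
  rw [toStarHom_apply, toStarHom_apply, toStarHom_apply]
  have := sum_comp ψ φ fun a b => ψ.V b * φ.V a * x * (ψ.V b * φ.V a)ᴴ
  refine this.trans ?_
  rw [Finset.sum_comm]
  refine Finset.sum_congr rfl fun b _ => ?_
  rw [Matrix.mul_sum, Matrix.sum_mul]
  refine Finset.sum_congr rfl fun a _ => ?_
  simp only [Matrix.conjTranspose_mul, Matrix.mul_assoc]

theorem IsUnital.comp {ψ : RigidEmbedding m l} {φ : RigidEmbedding n m} (hψ : ψ.IsUnital)
    (hφ : φ.IsUnital) : (ψ.comp φ).IsUnital := by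
  rw [IsUnital, comp_toStarHom, hφ, hψ]

/-- The value of a character on the multiset of types of the summands. -/
def charSum (φ : RigidEmbedding n m) (χ : D4Symmetry → ℤ) : ℤ := ∑ s, χ (φ.type s)

/-- The types of a composite are all products of a type of `φ` with a type of `ψ`, so the double sum
factors. -/
theorem charSum_comp (ψ : RigidEmbedding m l) (φ : RigidEmbedding n m) (χ : D4Symmetry → ℤ)
    (hχ : ∀ g h, χ (g.trans h) = χ g * χ h) :
    (ψ.comp φ).charSum χ = φ.charSum χ * ψ.charSum χ := by
  have := sum_comp ψ φ fun a b => χ ((φ.type a).trans (ψ.type b))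
  refine this.trans ?_
  simp only [hχ, charSum, Finset.sum_mul_sum]

open Classical in
/-- The number of summands of type `g`. -/
def count (φ : RigidEmbedding n m) (g : D4Symmetry) : ℕ :=
  (Finset.univ.filter fun s => φ.type s = g).card

/-- A rigid embedding is balanced if the nontrivial characters vanish on its types, that is,
if the four types occur equally often. -/
structure IsBalanced (φ : RigidEmbedding n m) : Prop where
  moveSign_zero : φ.charSum (moveSign 0) = 0
  moveSign_two : φ.charSum (moveSign 2) = 0
  cycleSign : φ.charSum cycleSign = 0

/-- Fourier inversion: summing `four_mul_indicator` over the summands leaves only the trivial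
character. -/
theorem IsBalanced.four_mul_count {φ : RigidEmbedding n m} (hφ : φ.IsBalanced) (g : D4Symmetry) :
    4 * φ.count g = φ.mult := by
  classical
  obtain ⟨h0, h2, h3⟩ := hφ
  have : (4 * φ.count g : ℤ) = φ.mult := by
    rw [count, Finset.card_filter]
    push_cast
    rw [Finset.mul_sum]
    simp only [four_mul_indicator, Finset.sum_add_distrib, ← Finset.mul_sum]
    unfold charSum at h0 h2 h3
    rw [h0, h2, h3]
    simp
  exact_mod_cast this

theorem IsBalanced.comp_left {ψ : RigidEmbedding m l} (hψ : ψ.IsBalanced)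
    (φ : RigidEmbedding n m) : (ψ.comp φ).IsBalanced where
  moveSign_zero := by rw [charSum_comp _ _ _ (moveSign_trans 0), hψ.moveSign_zero, mul_zero]
  moveSign_two := by rw [charSum_comp _ _ _ (moveSign_trans 2), hψ.moveSign_two, mul_zero]
  cycleSign := by rw [charSum_comp _ _ _ cycleSign_trans, hψ.cycleSign, mul_zero]

theorem sum_type_eq (φ : RigidEmbedding n m) (f : D4Symmetry → ℕ) :
    ∑ s, f (φ.type s) = ∑ k, φ.count (symmetry k) * f (symmetry k) := by
  classical
  let E := Equiv.ofBijective symmetry ⟨symmetry_injective, symmetry_surjective⟩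
  rw [← Finset.sum_fiberwise Finset.univ (fun s => E.symm (φ.type s))]
  refine Finset.sum_congr rfl fun k _ => ?_
  have h : ∀ s, E.symm (φ.type s) = k ↔ φ.type s = symmetry k := by
    intro s
    rw [Equiv.symm_apply_eq]; rfl
  simp only [h, count]
  rw [Finset.sum_congr rfl (g := fun _ => f (symmetry k)), Finset.sum_const, smul_eq_mul]
  intro s hs
  rw [(Finset.mem_filter.1 hs).2]

theorem symmetry_symm_apply (k j : Fin 4) : (symmetry k).symm j = symmetry k j := by
  revert k j; decide

/-- The orbit of `j` is `{j, mate j}`, and each of its points is reached from `j` by two symmetries.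
-/
theorem sum_symmetry_apply (f : Fin 4 → ℕ) (j : Fin 4) :
    ∑ k, f (symmetry k j) = 2 * (f j + f (mate j)) := by
  have : ∀ j, symmetry 0 j = j ∧ symmetry 3 j = mate j ∧
      ((symmetry 1 j = j ∧ symmetry 2 j = mate j) ∨ (symmetry 1 j = mate j ∧ symmetry 2 j = j)) := by
    decide
  obtain ⟨h0, h3, ⟨h1, h2⟩ | ⟨h1, h2⟩⟩ := this j <;>
    rw [Fin.sum_univ_four, h0, h1, h2, h3] <;> ring

theorem exists_equiv_of_count_eq {n' : Fin 4 → ℕ} (φ : RigidEmbedding n m) (ψ : RigidEmbedding n' l)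
    (h : ∀ g, φ.count g = ψ.count g) :
    ∃ e : Fin φ.mult ≃ Fin ψ.mult, ∀ s, ψ.type (e s) = φ.type s := by
  classical
  have : ∀ g, Nonempty ({s // φ.type s = g} ≃ {s // ψ.type s = g}) := by
    intro g
    refine ⟨Fintype.equivOfCardEq ?_⟩
    rw [Fintype.card_subtype, Fintype.card_subtype]
    simpa only [count] using h g
  let e := fun g => Classical.choice (this g)
  exact ⟨Equiv.ofFiberEquiv e, fun s => Equiv.ofFiberEquiv_map e s⟩

/-! ### Traces, sizes and membership under a rigid embedding -/

theorem blockProj_mul_V (φ : RigidEmbedding n m) (s : Fin φ.mult) (j : Fin 4) :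
    blockProj m j * φ.V s = φ.V s * blockProj n ((φ.type s).symm j) := by
  ext p q
  rw [blockProj, blockProj, Matrix.diagonal_mul, Matrix.mul_diagonal]
  by_cases h : p.1 = φ.type s q.1
  · have : p.1 = j ↔ q.1 = (φ.type s).symm j := by
      rw [h]
      constructor
      · rintro rfl; simp
      · intro h'; rw [h']; simp
    simp only [this, mul_comm]
  · rw [φ.block s p q h, mul_zero, zero_mul]

theorem blockTrace_toStarHom (φ : RigidEmbedding n m) (j : Fin 4) (x : FullMatrix n) :
    blockTrace j (φ.toStarHom x) = ∑ s, blockTrace ((φ.type s).symm j) x := by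
  rw [blockTrace, toStarHom_apply, Matrix.mul_sum, Matrix.trace_sum]
  refine Finset.sum_congr rfl fun s _ => ?_
  rw [Matrix.mul_assoc, ← Matrix.mul_assoc, blockProj_mul_V, ← Matrix.mul_assoc,
    Matrix.trace_mul_comm]
  simp only [← Matrix.mul_assoc]
  rw [φ.isometry, Matrix.one_mul]
  rfl

theorem trace_toStarHom (φ : RigidEmbedding n m) (x : FullMatrix n) :
    Matrix.trace (φ.toStarHom x) = φ.mult * Matrix.trace x := by
  rw [toStarHom_apply, Matrix.trace_sum]
  have : ∀ s, Matrix.trace (φ.V s * x * (φ.V s)ᴴ) = Matrix.trace x := by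
    intro s
    rw [Matrix.trace_mul_comm, ← Matrix.mul_assoc, φ.isometry, Matrix.one_mul]
  simp [this]

theorem IsUnital.dim_eq {φ : RigidEmbedding n m} (hφ : φ.IsUnital) (j : Fin 4) :
    m j = ∑ s, n ((φ.type s).symm j) := by
  have h := blockTrace_toStarHom φ j 1
  rw [hφ, blockTrace_one] at h
  simp only [blockTrace_one] at h
  exact_mod_cast h

theorem IsUnital.mult_mul {φ : RigidEmbedding n m} (hφ : φ.IsUnital) :
    φ.mult * ∑ i, n i = ∑ i, m i := by
  have h := trace_toStarHom φ 1
  rw [hφ, Matrix.trace_one, Matrix.trace_one] at h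
  simp only [Fintype.card_sigma, Fintype.card_fin] at h
  exact_mod_cast h.symm

/-- The block sizes of the range of a balanced unital embedding. -/
theorem IsBalanced.dim_eq {φ : RigidEmbedding n m} (hφ : φ.IsBalanced) (hu : φ.IsUnital)
    (j : Fin 4) : 2 * m j = φ.mult * (n j + n (mate j)) := by
  have h := hu.dim_eq j
  rw [φ.sum_type_eq fun g => n (g.symm j)] at h
  have h4 : 4 * m j = φ.mult * (2 * (n j + n (mate j))) := by
    rw [h, Finset.mul_sum, ← sum_symmetry_apply, Finset.mul_sum]
    refine Finset.sum_congr rfl fun k _ => ?_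
    rw [← mul_assoc, hφ.four_mul_count, symmetry_symm_apply]
  linarith

/-- The summands have orthogonal ranges, so compression to one of them undoes the embedding. One
summand thus suffices for injectivity and for detecting membership in the 4-cycle algebra. -/
theorem conj_toStarHom (φ : RigidEmbedding n m) (s : Fin φ.mult) (x : FullMatrix n) :
    (φ.V s)ᴴ * φ.toStarHom x * φ.V s = x := by
  rw [toStarHom_apply, Matrix.mul_sum, Matrix.sum_mul, Finset.sum_eq_single s]
  · rw [← Matrix.mul_assoc, ← Matrix.mul_assoc, φ.isometry, Matrix.one_mul, Matrix.mul_assoc,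
      φ.isometry, Matrix.mul_one]
  · intro t _ hts
    rw [← Matrix.mul_assoc, ← Matrix.mul_assoc, φ.orthogonal _ _ hts.symm]
    simp
  · simp

theorem toStarHom_mem_fourCycle (φ : RigidEmbedding n m) {x : FullMatrix n}
    (hx : x ∈ fourCycleAlgebra n) : φ.toStarHom x ∈ fourCycleAlgebra m := by
  rw [toStarHom_apply]
  refine Subalgebra.sum_mem _ fun s _ p q hpq => ?_
  rw [Matrix.mul_apply]
  refine Finset.sum_eq_zero fun b _ => ?_
  rw [Matrix.conjTranspose_apply]
  by_cases hb : q.1 = φ.type s b.1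
  · rw [Matrix.mul_apply, Finset.sum_eq_zero, zero_mul]
    intro a _
    by_cases ha : p.1 = φ.type s a.1
    · rw [hx a b, mul_zero]
      rw [ha, hb] at hpq
      exact fun h => hpq ((φ.type s).map_rel_iff.2 h)
    · rw [φ.block s p a ha, zero_mul]
  · rw [φ.block s q b hb, star_zero, mul_zero]

theorem toStarHom_mem_fourCycle_iff (φ : RigidEmbedding n m) (s : Fin φ.mult) {x : FullMatrix n} :
    φ.toStarHom x ∈ fourCycleAlgebra m ↔ x ∈ fourCycleAlgebra n := by
  refine ⟨fun hx p q hpq => ?_, φ.toStarHom_mem_fourCycle⟩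
  rw [← φ.conj_toStarHom s x, Matrix.mul_apply]
  refine Finset.sum_eq_zero fun b _ => ?_
  by_cases hb : b.1 = φ.type s q.1
  · rw [Matrix.mul_apply, Finset.sum_eq_zero, zero_mul]
    intro a _
    rw [Matrix.conjTranspose_apply]
    by_cases ha : a.1 = φ.type s p.1
    · rw [hx a b, mul_zero]
      rw [ha, hb]
      exact fun h => hpq ((φ.type s).map_rel_iff.1 h)
    · rw [φ.block s a p ha, star_zero, zero_mul]
  · rw [φ.block s b q hb, mul_zero]

theorem toStarHom_injective (φ : RigidEmbedding n m) (s : Fin φ.mult) :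
    Function.Injective φ.toStarHom := fun x y h => by
  rw [← φ.conj_toStarHom s x, h, φ.conj_toStarHom]

theorem toStarHom_isBlockDiagonal (φ : RigidEmbedding n m) {x : FullMatrix n}
    (hx : IsBlockDiagonal x) : IsBlockDiagonal (φ.toStarHom x) := by
  rw [← mem_fourCycle_and_star_iff] at hx ⊢
  rw [← map_star]
  exact ⟨φ.toStarHom_mem_fourCycle hx.1, φ.toStarHom_mem_fourCycle hx.2⟩

/-- The rigid embedding permuting matrix units according to a bijection of index sets. -/
def ofEquiv {N : ℕ} (t : Fin N → D4Symmetry) (E : Fin N × Idx n ≃ Idx m)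
    (hE : ∀ s p, (E (s, p)).1 = t s p.1) : RigidEmbedding n m where
  mult := N
  type := t
  V s := Matrix.of fun p q => if p = E (s, q) then 1 else 0
  isometry s := by
    ext p q
    simp [Matrix.mul_apply, Matrix.one_apply, eq_comm]
  orthogonal s t h := by
    ext p q
    simp [Matrix.mul_apply, Ne.symm h]
  block s p q h := by
    simp only [Matrix.of_apply]
    refine if_neg fun h' => h ?_
    rw [h', hE]

theorem toStarHom_apply_of_equiv (φ : RigidEmbedding n m) (E : Fin φ.mult × Idx n ≃ Idx m)
    (hE : ∀ s p q, φ.V s p q = if p = E (s, q) then 1 else 0) (x : FullMatrix n)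
    (s t : Fin φ.mult) (p q : Idx n) :
    φ.toStarHom x (E (s, p)) (E (t, q)) = if s = t then x p q else 0 := by
  rw [toStarHom_apply, Matrix.sum_apply]
  have : ∀ u, (φ.V u * x * (φ.V u)ᴴ) (E (s, p)) (E (t, q)) =
      if s = u ∧ t = u then x p q else 0 := by
    intro u
    rw [Matrix.mul_apply]
    have h1 : ∀ b, (φ.V u * x) (E (s, p)) b = if s = u then x p b else 0 := by
      intro b
      rw [Matrix.mul_apply]
      by_cases hs : s = u
      · simp [hE, hs]
      · simp [hE, hs]
    simp only [h1, Matrix.conjTranspose_apply, hE]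
    by_cases hs : s = u <;> by_cases ht : t = u <;> simp [hs, ht]
  simp only [this]
  split_ifs with hst
  · subst hst; simp
  · refine Finset.sum_eq_zero fun u _ => if_neg ?_
    rintro ⟨rfl, rfl⟩; exact hst rfl

theorem isUnital_of_equiv (φ : RigidEmbedding n m) (E : Fin φ.mult × Idx n ≃ Idx m)
    (hE : ∀ s p q, φ.V s p q = if p = E (s, q) then 1 else 0) : φ.IsUnital := by
  ext p q
  obtain ⟨⟨s, p⟩, rfl⟩ := E.surjective p
  obtain ⟨⟨t, q⟩, rfl⟩ := E.surjective q
  rw [toStarHom_apply_of_equiv φ E hE]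
  simp only [Matrix.one_apply, E.injective.eq_iff, Prod.mk.injEq, ite_and]

/-- Counting is enough: for each `j`, the coordinates that the copies send to block `j` are as many
as that block has. Bijections of these fibres assemble into a relabelling of coordinates. -/
theorem exists_unital_of_types {N : ℕ} (t : Fin N → D4Symmetry)
    (h : ∀ j, m j = ∑ s, n ((t s).symm j)) :
    ∃ φ : RigidEmbedding n m, φ.IsUnital ∧
      ∃ e : Fin φ.mult ≃ Fin N, ∀ s, φ.type s = t (e s) := by
  have key : ∀ j, Nonempty ({a : Fin N × Idx n // t a.1 a.2.1 = j} ≃ {b : Idx m // b.1 = j}) := by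
    intro j
    refine ⟨Fintype.equivOfCardEq ?_⟩
    rw [Fintype.card_subtype, Fintype.card_subtype, Finset.card_filter, Finset.card_filter,
      Fintype.sum_prod_type, Fintype.sum_sigma, Finset.sum_eq_single j]
    · simp only [if_true, Finset.sum_const, Finset.card_univ, Fintype.card_fin, smul_eq_mul,
        mul_one, h]
      refine Finset.sum_congr rfl fun s _ => ?_
      rw [Fintype.sum_sigma, Finset.sum_eq_single ((t s).symm j)]
      · simp
      · intro i _ hi
        refine Finset.sum_eq_zero fun _ _ => if_neg ?_
        rintro rfl
        simp at hi
      · simp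
    · intro i _ hi
      exact Finset.sum_eq_zero fun _ _ => if_neg hi
    · simp
  let e := fun j => Classical.choice (key j)
  let E := Equiv.ofFiberEquiv e
  have hE : ∀ s p, (E (s, p)).1 = t s p.1 := fun s p => Equiv.ofFiberEquiv_map e (s, p)
  exact ⟨ofEquiv t E hE, isUnital_of_equiv _ E fun _ _ _ => rfl, Equiv.refl _, fun _ => rfl⟩

/-- Unital rigid embeddings with the same types are conjugate by a block diagonal unitary. -/
theorem exists_unitary {φ ψ : RigidEmbedding n m} (hφ : φ.IsUnital) (e : Fin φ.mult ≃ Fin ψ.mult)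
    (he : ∀ s, ψ.type (e s) = φ.type s) :
    ∃ U : FullMatrix m, Uᴴ * U = 1 ∧ IsBlockDiagonal U ∧ ∀ s, U * φ.V s = ψ.V (e s) := by
  rw [isUnital_iff] at hφ
  -- The unitary takes the range of each summand of `φ` onto that of its partner, through their
  -- common initial space. It is block diagonal because partners have equal type.
  have hU : ∀ s, (∑ t, ψ.V (e t) * (φ.V t)ᴴ) * φ.V s = ψ.V (e s) := by
    intro s
    rw [Matrix.sum_mul, Finset.sum_eq_single s]
    · rw [Matrix.mul_assoc, φ.isometry, Matrix.mul_one]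
    · intro t _ hts
      rw [Matrix.mul_assoc, φ.orthogonal _ _ hts, Matrix.mul_zero]
    · simp
  refine ⟨∑ s, ψ.V (e s) * (φ.V s)ᴴ, ?_, ?_, hU⟩
  · have h1 : ∀ s, (∑ t, ψ.V (e t) * (φ.V t)ᴴ)ᴴ * ψ.V (e s) = φ.V s := by
      intro s
      rw [Matrix.conjTranspose_sum, Matrix.sum_mul, Finset.sum_eq_single s]
      · rw [Matrix.conjTranspose_mul, Matrix.conjTranspose_conjTranspose, Matrix.mul_assoc,
          ψ.isometry, Matrix.mul_one]
      · intro t _ hts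
        rw [Matrix.conjTranspose_mul, Matrix.mul_assoc, ψ.orthogonal _ _ (e.injective.ne hts),
          Matrix.mul_zero]
      · simp
    rw [Matrix.mul_sum]
    simp only [← Matrix.mul_assoc, h1]
    exact hφ
  · intro p q hpq
    rw [Matrix.sum_apply]
    refine Finset.sum_eq_zero fun s _ => ?_
    rw [Matrix.mul_apply]
    refine Finset.sum_eq_zero fun a _ => ?_
    rw [Matrix.conjTranspose_apply]
    by_cases hp : p.1 = φ.type s a.1
    · rw [φ.block s q a fun h => hpq (hp.trans h.symm), star_zero, mul_zero]
    · rw [ψ.block (e s) p a (by rw [he]; exact hp), zero_mul]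

/-- The composite of a rigid embedding with conjugation by a block diagonal unitary. -/
def conj (φ : RigidEmbedding n m) (U : FullMatrix m) (hU : Uᴴ * U = 1) (hd : IsBlockDiagonal U) :
    RigidEmbedding n m where
  mult := φ.mult
  type := φ.type
  V s := U * φ.V s
  isometry s := by
    rw [Matrix.conjTranspose_mul, Matrix.mul_assoc, ← Matrix.mul_assoc _ U, hU, Matrix.one_mul,
      φ.isometry]
  orthogonal s t h := by
    rw [Matrix.conjTranspose_mul, Matrix.mul_assoc, ← Matrix.mul_assoc _ U, hU, Matrix.one_mul,
      φ.orthogonal _ _ h]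
  block s p q h := by
    rw [Matrix.mul_apply]
    refine Finset.sum_eq_zero fun a _ => ?_
    by_cases hp : p.1 = a.1
    · rw [φ.block s a q (by rwa [← hp]), mul_zero]
    · rw [hd p a hp, zero_mul]

theorem conj_toStarHom_apply (φ : RigidEmbedding n m) (U : FullMatrix m) (hU : Uᴴ * U = 1)
    (hd : IsBlockDiagonal U) (x : FullMatrix n) :
    (φ.conj U hU hd).toStarHom x = U * φ.toStarHom x * Uᴴ := by
  rw [toStarHom_apply, toStarHom_apply, Matrix.mul_sum, Matrix.sum_mul]
  refine Finset.sum_congr rfl fun s _ => ?_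
  change U * φ.V s * x * (U * φ.V s)ᴴ = _
  simp only [Matrix.conjTranspose_mul, Matrix.mul_assoc]

/-- A unital rigid embedding `γ` can be corrected so that its composite with `δ` becomes a
prescribed rigid embedding with the same types. -/
theorem exists_factor (δ : RigidEmbedding n m) (γ : RigidEmbedding m l) (ψ : RigidEmbedding n l)
    (hδ : δ.IsUnital) (hγ : γ.IsUnital) (h : ∀ g, (γ.comp δ).count g = ψ.count g) :
    ∃ γ' : RigidEmbedding m l, γ'.IsUnital ∧ ∀ x, γ'.toStarHom (δ.toStarHom x) = ψ.toStarHom x := by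
  obtain ⟨e, he⟩ := exists_equiv_of_count_eq _ _ h
  obtain ⟨U, hU, hd, hUV⟩ := exists_unitary (hγ.comp hδ) e he
  refine ⟨γ.conj U hU hd, ?_, fun x => ?_⟩
  · rw [IsUnital, conj_toStarHom_apply, hγ, Matrix.mul_one]
    exact mul_eq_one_comm.1 hU
  · rw [conj_toStarHom_apply, ← comp_toStarHom, toStarHom_apply, toStarHom_apply, Matrix.mul_sum,
      Matrix.sum_mul]
    refine Fintype.sum_equiv e _ _ fun s => ?_
    rw [← hUV, Matrix.conjTranspose_mul]
    simp only [Matrix.mul_assoc]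

end RigidEmbedding

/-! ### Composites in a rigid system -/

theorem RigidEmbedding.IsUnital.mult_pos {n m : Fin 4 → ℕ} {φ : RigidEmbedding n m}
    (hφ : φ.IsUnital) (hm : ∀ i, 0 < m i) : 0 < φ.mult := by
  rcases Nat.eq_zero_or_pos φ.mult with h | h
  · have := hφ.mult_mul
    rw [h, zero_mul] at this
    have h0 := Finset.single_le_sum (f := m) (fun i _ => Nat.zero_le _) (Finset.mem_univ 0)
    have := hm 0
    omega
  · exact h

/-- A single sign cannot sum to zero. -/
theorem RigidEmbedding.two_le_mult {n m : Fin 4 → ℕ} {φ : RigidEmbedding n m} (h : 0 < φ.mult)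
    (h0 : φ.charSum (moveSign 0) = 0) : 2 ≤ φ.mult := by
  by_contra hlt
  have h1 : φ.mult = 1 := by omega
  have hs : Subsingleton (Fin φ.mult) := by rw [h1]; infer_instance
  rw [RigidEmbedding.charSum, Fintype.sum_subsingleton _ (⟨0, h⟩ : Fin φ.mult)] at h0
  rcases moveSign_eq_or 0 (φ.type ⟨0, h⟩) with h' | h' <;> omega

namespace RigidSystem

variable (S : RigidSystem)

/-- The composite embedding `A_k → A_{k+d}`. -/
def comp (k : ℕ) : ∀ d, RigidEmbedding (S.dim k) (S.dim (k + d))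
  | 0 => RigidEmbedding.refl _
  | d + 1 => (S.emb (k + d)).comp (comp k d)

theorem comp_charSum (k d : ℕ) (χ : D4Symmetry → ℤ) (hχ : ∀ g h, χ (g.trans h) = χ g * χ h)
    (h1 : χ (RelIso.refl D4) = 1) :
    (S.comp k d).charSum χ = ∏ i ∈ Finset.range d, (S.emb (k + i)).charSum χ := by
  induction d with
  | zero =>
    change ∑ s : Fin 1, χ (RelIso.refl D4) = 1
    simp [h1]
  | succ d ih =>
    rw [Finset.prod_range_succ, ← ih]
    exact RigidEmbedding.charSum_comp _ _ _ hχ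

theorem comp_charSum_eq_zero {k d l : ℕ} (χ : D4Symmetry → ℤ)
    (hχ : ∀ g h, χ (g.trans h) = χ g * χ h) (h1 : χ (RelIso.refl D4) = 1) (hkl : k ≤ l)
    (hl : l < k + d) (h : (S.emb l).charSum χ = 0) : (S.comp k d).charSum χ = 0 := by
  rw [comp_charSum S k d χ hχ h1]
  refine Finset.prod_eq_zero (i := l - k) (Finset.mem_range.2 (by omega)) ?_
  rwa [Nat.add_sub_cancel' hkl]

theorem comp_isUnital {k : ℕ} (h : ∀ l, k ≤ l → (S.emb l).IsUnital) (d : ℕ) :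
    (S.comp k d).IsUnital := by
  induction d with
  | zero => exact RigidEmbedding.refl_isUnital
  | succ d ih => exact (h _ (Nat.le_add_right k d)).comp ih

namespace Realization

variable {S} {B : Type*} [NonUnitalRing B] [StarRing B] [Module ℂ B] (ι : S.Realization B)

theorem incl_comp (k d : ℕ) (x : FullMatrix (S.dim k)) :
    ι.incl (k + d) ((S.comp k d).toStarHom x) = ι.incl k x := by
  induction d with
  | zero => exact congrArg _ (RigidEmbedding.refl_toStarHom x)
  | succ d ih =>
    rw [← ih]
    refine Eq.trans ?_ (ι.compatible (k + d) _)
    exact congrArg _ (RigidEmbedding.comp_toStarHom _ _ _)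

theorem exists_incl_eq {k l : ℕ} (h : k ≤ l) (x : FullMatrix (S.dim k)) :
    ∃ y, ι.incl l y = ι.incl k x := by
  obtain ⟨d, rfl⟩ := Nat.exists_eq_add_of_le h
  exact ⟨_, ι.incl_comp k d x⟩

theorem exists_incl_eq_of_mem {k l : ℕ} (h : k ≤ l) {x : FullMatrix (S.dim k)}
    (hx : x ∈ fourCycleAlgebra (S.dim k)) :
    ∃ y ∈ fourCycleAlgebra (S.dim l), ι.incl l y = ι.incl k x := by
  obtain ⟨d, rfl⟩ := Nat.exists_eq_add_of_le h
  exact ⟨_, (S.comp k d).toStarHom_mem_fourCycle hx, ι.incl_comp k d x⟩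

theorem exists_incl_eq_of_isBlockDiagonal {k l : ℕ} (h : k ≤ l) {x : FullMatrix (S.dim k)}
    (hx : IsBlockDiagonal x) : ∃ y, IsBlockDiagonal y ∧ ι.incl l y = ι.incl k x := by
  obtain ⟨d, rfl⟩ := Nat.exists_eq_add_of_le h
  exact ⟨_, (S.comp k d).toStarHom_isBlockDiagonal hx, ι.incl_comp k d x⟩

theorem mem_selfAdjointPart_iff (b : B) :
    b ∈ ι.selfAdjointPart ↔ ∃ k x, IsBlockDiagonal x ∧ ι.incl k x = b := by
  constructor
  · rintro ⟨⟨k, x, hx, rfl⟩, l, y, hy, h⟩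
    obtain ⟨x', hx', hxx'⟩ := ι.exists_incl_eq_of_mem (le_max_left k l) hx
    obtain ⟨y', hy', hyy'⟩ := ι.exists_incl_eq_of_mem (le_max_right k l) hy
    refine ⟨max k l, x', ?_, hxx'⟩
    rw [← mem_fourCycle_and_star_iff]
    refine ⟨hx', ?_⟩
    have : star x' = y' := ι.injective _ (by rw [map_star, hxx', hyy', h])
    rwa [this]
  · rintro ⟨k, x, hx, rfl⟩
    rw [← mem_fourCycle_and_star_iff] at hx
    exact ⟨⟨k, x, hx.1, rfl⟩, k, star x, hx.2, map_star _ _⟩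

end Realization

/-- A rigid system whose embeddings are unital from the `K`-th on, with algebras of dyadic size, and
in which each nontrivial character of the symmetry group of `D₄` vanishes on infinitely many
embeddings. -/
structure IsDyadic (K : ℕ) : Prop where
  unital : ∀ k, K ≤ k → (S.emb k).IsUnital
  dim_add : ∀ k, K ≤ k → ∃ j, S.dim k 0 + S.dim k 1 = 2 ^ j ∧ S.dim k 2 + S.dim k 3 = 2 ^ j
  moveSign_zero : ∀ k, ∃ l, k ≤ l ∧ (S.emb l).charSum (moveSign 0) = 0
  moveSign_two : ∀ k, ∃ l, k ≤ l ∧ (S.emb l).charSum (moveSign 2) = 0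
  cycleSign : ∀ k, ∃ l, k ≤ l ∧ (S.emb l).charSum cycleSign = 0

variable {S} {K : ℕ}

/-- From stage `K` on the total size never decreases, and it at least doubles at each of the
infinitely many zeros of `moveSign 0`. -/
theorem IsDyadic.exists_le_dim (h : S.IsDyadic K) (M : ℕ) :
    ∃ l, K ≤ l ∧ ∀ l', l ≤ l' → M ≤ ∑ i, S.dim l' i := by
  have hstep : ∀ k, K ≤ k → ∑ i, S.dim (k + 1) i = (S.emb k).mult * ∑ i, S.dim k i :=
    fun k hk => (h.unital k hk).mult_mul.symm
  have hpos : ∀ k, K ≤ k → 0 < (S.emb k).mult := fun k hk =>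
    (h.unital k hk).mult_pos (S.dim_pos _)
  have hmono : ∀ k l, K ≤ k → k ≤ l → ∑ i, S.dim k i ≤ ∑ i, S.dim l i := by
    intro k l hk hkl
    induction l, hkl using Nat.le_induction with
    | base => exact le_rfl
    | succ l hl ih =>
      rw [hstep l (hk.trans hl)]
      exact ih.trans (Nat.le_mul_of_pos_left _ (hpos l (hk.trans hl)))
  induction M with
  | zero => exact ⟨K, le_rfl, fun _ _ => Nat.zero_le _⟩
  | succ M ih =>
    obtain ⟨l, hKl, hl⟩ := ih
    obtain ⟨l1, hl1, hc⟩ := h.moveSign_zero l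
    refine ⟨l1 + 1, by omega, fun l' hl' => le_trans ?_ (hmono (l1 + 1) l' (by omega) hl')⟩
    rw [hstep l1 (by omega)]
    have h2 := RigidEmbedding.two_le_mult (hpos l1 (by omega)) hc
    have h3 := hl l1 hl1
    have h4 : 0 < ∑ i, S.dim l1 i :=
      Finset.sum_pos (fun i _ => S.dim_pos l1 i) Finset.univ_nonempty
    nlinarith

/-- A stretch that meets a zero of every character composes to a balanced embedding. By
`IsBalanced.dim_eq` the two blocks of a side then have equal size; the two sides agree by `dim_add`.
-/
theorem IsDyadic.exists_balanced (h : S.IsDyadic K) {k : ℕ} (hk : K ≤ k) (N : ℕ) :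
    ∃ d, N ≤ d ∧ (S.comp k d).IsBalanced ∧ ∃ e, N ≤ e ∧ ∀ i, S.dim (k + d) i = 2 ^ e := by
  obtain ⟨l0, hl0, h0⟩ := h.moveSign_zero k
  obtain ⟨l2, hl2, h2⟩ := h.moveSign_two k
  obtain ⟨l3, hl3, h3⟩ := h.cycleSign k
  obtain ⟨l4, hl4, h4⟩ := h.exists_le_dim (4 * 2 ^ N)
  -- `k + d` lies beyond all four chosen stages; `l4` makes the final blocks at least `2 ^ N` in
  -- size.
  let d := N + l0 + l2 + l3 + l4 + 1
  have hb : (S.comp k d).IsBalanced :=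
    ⟨S.comp_charSum_eq_zero _ (moveSign_trans 0) (by simp [moveSign]) hl0 (by omega) h0,
      S.comp_charSum_eq_zero _ (moveSign_trans 2) (by simp [moveSign]) hl2 (by omega) h2,
      S.comp_charSum_eq_zero _ cycleSign_trans (by simp [moveSign, FourCycle.cycleSign])
        hl3 (by omega) h3⟩
  have hu : (S.comp k d).IsUnital := S.comp_isUnital (fun l hl => h.unital l (hk.trans hl)) d
  refine ⟨d, by omega, hb, ?_⟩
  obtain ⟨a, ha, ha'⟩ := h.dim_add k hk
  obtain ⟨b, hb1, -⟩ := h.dim_add (k + d) (by omega)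
  have e0 := hb.dim_eq hu 0
  have e1 := hb.dim_eq hu 1
  have e2 := hb.dim_eq hu 2
  have e3 := hb.dim_eq hu 3
  have hm : mate 0 = 1 ∧ mate 1 = 0 ∧ mate 2 = 3 ∧ mate 3 = 2 := by decide
  rw [hm.1, ha] at e0
  rw [hm.2.1, add_comm (S.dim k 1), ha] at e1
  rw [hm.2.2.1, ha'] at e2
  rw [hm.2.2.2, add_comm (S.dim k 3), ha'] at e3
  have hT := h4 (k + d) (by omega)
  rw [Fin.sum_univ_four] at hT
  have hN : 0 < 2 ^ N := by positivity
  obtain ⟨e, rfl⟩ : ∃ e, b = e + 1 := by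
    refine ⟨b - 1, ?_⟩
    rcases b with _ | b
    · rw [pow_zero] at hb1; omega
    · simp
  rw [pow_succ] at hb1
  refine ⟨e, ?_, fun i => ?_⟩
  · rw [← Nat.pow_le_pow_iff_right (a := 2) (by norm_num)]
    omega
  · fin_cases i
    · change S.dim (k + d) 0 = _; omega
    · change S.dim (k + d) 1 = _; omega
    · change S.dim (k + d) 2 = _; omega
    · change S.dim (k + d) 3 = _; omega

end RigidSystem

/-- Balanced unital embeddings exist between 4-cycle algebras with constant dyadic block sizes. -/
theorem RigidEmbedding.exists_balanced {n m : Fin 4 → ℕ} {a b : ℕ} (hn : ∀ i, n i = 2 ^ a)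
    (hm : ∀ i, m i = 2 ^ b) (hab : a + 2 ≤ b) :
    ∃ γ : RigidEmbedding n m, γ.IsUnital ∧ γ.IsBalanced := by
  obtain ⟨c, rfl⟩ := Nat.exists_eq_add_of_le hab
  obtain ⟨γ, hu, e, he⟩ := RigidEmbedding.exists_unital_of_types (n := n) (m := m)
    -- Each symmetry occurs `2 ^ c` times; the four of them account for the gap of two in the
    -- exponents.
    (fun s : Fin (4 * 2 ^ c) => symmetry (finProdFinEquiv.symm s).1) (by
      intro j
      simp only [hn, hm, Finset.sum_const, Finset.card_univ, Fintype.card_fin, smul_eq_mul]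
      ring)
  have key : ∀ χ : D4Symmetry → ℤ, ∑ k, χ (symmetry k) = 0 → γ.charSum χ = 0 := by
    intro χ hχ
    rw [RigidEmbedding.charSum,
      Fintype.sum_equiv (e.trans finProdFinEquiv.symm) _ (fun p => χ (symmetry p.1))
        fun s => by rw [he]; rfl,
      Fintype.sum_prod_type]
    simp [← Finset.mul_sum, hχ]
  exact ⟨γ, hu, key _ (by decide), key _ (by decide), key _ (by decide)⟩

/-! ### Star homomorphisms from their graphs -/

section Graph

variable {P Q C : Type*}
  [NonUnitalRing P] [StarRing P] [Module ℂ P] [NonUnitalRing Q] [StarRing Q] [Module ℂ Q]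
  [NonUnitalRing C] [StarRing C] [Module ℂ C]

/-- A relation compatible with the operations of a complex `*`-algebra. -/
structure IsStarRelation (G : Set (P × Q)) : Prop where
  zero : 0 ∈ G
  add : ∀ a ∈ G, ∀ b ∈ G, a + b ∈ G
  mul : ∀ a ∈ G, ∀ b ∈ G, a * b ∈ G
  smul : ∀ (c : ℂ), ∀ a ∈ G, c • a ∈ G
  star : ∀ a ∈ G, star a ∈ G

theorem isStarRelation_range (f : C →⋆ₙₐ[ℂ] P) (g : C →⋆ₙₐ[ℂ] Q) :
    IsStarRelation (Set.range fun x => (f x, g x)) where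
  zero := ⟨0, by simp⟩
  add := by rintro _ ⟨x, rfl⟩ _ ⟨y, rfl⟩; exact ⟨x + y, by simp⟩
  mul := by rintro _ ⟨x, rfl⟩ _ ⟨y, rfl⟩; exact ⟨x * y, by simp⟩
  smul := by rintro c _ ⟨x, rfl⟩; exact ⟨c • x, by simp⟩
  star := by rintro _ ⟨x, rfl⟩; exact ⟨Star.star x, by simp [map_star, Prod.star_def]⟩

theorem isStarRelation_iUnion {R : ℕ → Set (P × Q)} (hR : Monotone R)
    (h : ∀ i, IsStarRelation (R i)) : IsStarRelation (⋃ i, R i) where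
  zero := Set.mem_iUnion.2 ⟨0, (h 0).zero⟩
  add a ha b hb := by
    obtain ⟨i, hi⟩ := Set.mem_iUnion.1 ha
    obtain ⟨j, hj⟩ := Set.mem_iUnion.1 hb
    exact Set.mem_iUnion.2 ⟨max i j, (h _).add _ (hR (le_max_left i j) hi) _
      (hR (le_max_right i j) hj)⟩
  mul a ha b hb := by
    obtain ⟨i, hi⟩ := Set.mem_iUnion.1 ha
    obtain ⟨j, hj⟩ := Set.mem_iUnion.1 hb
    exact Set.mem_iUnion.2 ⟨max i j, (h _).mul _ (hR (le_max_left i j) hi) _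
      (hR (le_max_right i j) hj)⟩
  smul c a ha := by
    obtain ⟨i, hi⟩ := Set.mem_iUnion.1 ha
    exact Set.mem_iUnion.2 ⟨i, (h i).smul c _ hi⟩
  star a ha := by
    obtain ⟨i, hi⟩ := Set.mem_iUnion.1 ha
    exact Set.mem_iUnion.2 ⟨i, (h i).star _ hi⟩

/-- Maps on limits are built as increasing unions of graphs of maps on finite stages, where closure
under the operations is inherited directly. -/
theorem IsStarRelation.exists_starHom {G : Set (P × Q)} (hG : IsStarRelation G)
    (total : ∀ p, ∃ q, (p, q) ∈ G) (unique : ∀ p q q', (p, q) ∈ G → (p, q') ∈ G → q = q') :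
    ∃ f : P →⋆ₙₐ[ℂ] Q, ∀ p q, (p, q) ∈ G ↔ f p = q := by
  choose f hf using total
  refine ⟨{ toFun := f
            map_smul' := fun c p => unique _ _ _ (hf _) (hG.smul c _ (hf p))
            map_zero' := unique _ _ _ (hf _) hG.zero
            map_add' := fun p p' => unique _ _ _ (hf _) (hG.add _ (hf p) _ (hf p'))
            map_mul' := fun p p' => unique _ _ _ (hf _) (hG.mul _ (hf p) _ (hf p'))
            map_star' := fun p => unique _ _ _ (hf _) (hG.star _ (hf p)) }, fun p q => ?_⟩
  exact ⟨fun h => unique _ _ _ (hf p) h, fun h => h ▸ hf p⟩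

theorem IsStarRelation.exists_starEquiv {G : Set (P × Q)} (hG : IsStarRelation G)
    (total : ∀ p, ∃ q, (p, q) ∈ G) (unique : ∀ p q q', (p, q) ∈ G → (p, q') ∈ G → q = q')
    (total' : ∀ q, ∃ p, (p, q) ∈ G) (unique' : ∀ p p' q, (p, q) ∈ G → (p', q) ∈ G → p = p') :
    ∃ f : P ≃⋆ₐ[ℂ] Q, ∀ p, (p, f p) ∈ G := by
  obtain ⟨f, hf⟩ := hG.exists_starHom total unique
  have hb : Function.Bijective f := by
    refine ⟨fun p p' h => unique' p p' (f p') ?_ ((hf _ _).2 rfl), fun q => ?_⟩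
    · exact (hf _ _).2 h
    · obtain ⟨p, hp⟩ := total' q
      exact ⟨p, (hf _ _).1 hp⟩
  exact ⟨StarAlgEquiv.ofBijective f hb, fun p => (hf _ _).2 rfl⟩

end Graph

/-! ### The intertwining argument -/

section Intertwining

variable {S T : RigidSystem} {K K' : ℕ} {B B' : Type*}
  [NonUnitalRing B] [StarRing B] [Module ℂ B] [NonUnitalRing B'] [StarRing B'] [Module ℂ B']

/-- A partial isomorphism between two limits, implemented by unital rigid embeddings of a common
4-cycle algebra in building blocks of the two systems. -/
def IsPartialIso (ι : S.Realization B) (ι' : T.Realization B') (K K' : ℕ) (R : Set (B × B')) :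
    Prop :=
  ∃ (n : Fin 4 → ℕ) (k k' : ℕ) (φ : RigidEmbedding n (S.dim k)) (φ' : RigidEmbedding n (T.dim k')),
    (∀ i, 0 < n i) ∧ K ≤ k ∧ K' ≤ k' ∧ φ.IsUnital ∧ φ'.IsUnital ∧
      R = Set.range fun x => (ι.incl k (φ.toStarHom x), ι'.incl k' (φ'.toStarHom x))

variable {ι : S.Realization B} {ι' : T.Realization B'} {R : Set (B × B')}

theorem IsPartialIso.swap (h : IsPartialIso ι ι' K K' R) :
    IsPartialIso ι' ι K' K (Prod.swap '' R) := by
  obtain ⟨n, k, k', φ, φ', hn, hk, hk', hφ, hφ', rfl⟩ := h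
  refine ⟨n, k', k, φ', φ, hn, hk', hk, hφ', hφ, ?_⟩
  rw [← Set.range_comp]
  rfl

theorem IsPartialIso.isStarRelation (h : IsPartialIso ι ι' K K' R) : IsStarRelation R := by
  obtain ⟨n, k, k', φ, φ', -, -, -, -, -, rfl⟩ := h
  exact isStarRelation_range ((ι.incl k).comp φ.toStarHom) ((ι'.incl k').comp φ'.toStarHom)

theorem IsPartialIso.eq_right (h : IsPartialIso ι ι' K K' R) {b : B} {b₁ b₂ : B'}
    (h₁ : (b, b₁) ∈ R) (h₂ : (b, b₂) ∈ R) : b₁ = b₂ := by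
  obtain ⟨n, k, k', φ, φ', hn, -, -, hφ, -, rfl⟩ := h
  obtain ⟨x, hx⟩ := h₁
  obtain ⟨y, hy⟩ := h₂
  simp only [Prod.mk.injEq] at hx hy
  have : x = y := φ.toStarHom_injective ⟨0, hφ.mult_pos (S.dim_pos k)⟩
    (ι.injective k (hx.1.trans hy.1.symm))
  rw [← hx.2, ← hy.2, this]

/-- Membership is tested in the common building block with sizes `n`: a unital rigid embedding into
a later stage of `S` detects it there, and `φ'` pushes it forward. -/
theorem IsPartialIso.mem_limitAlgebra (hS : S.IsDyadic K) (h : IsPartialIso ι ι' K K' R) {b : B} {b' : B'}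
    (hb : (b, b') ∈ R) (hA : b ∈ ι.limitAlgebra) : b' ∈ ι'.limitAlgebra := by
  obtain ⟨n, k, k', φ, φ', hn, hk, -, hφ, hφ', rfl⟩ := h
  obtain ⟨x, hx⟩ := hb
  simp only [Prod.mk.injEq] at hx
  obtain ⟨l, y, hy, hyb⟩ := hA
  obtain ⟨y', hy', hyy'⟩ := ι.exists_incl_eq_of_mem (le_max_right k l) hy
  have h1 : x ∈ fourCycleAlgebra n := by
    obtain ⟨d, hd⟩ := Nat.exists_eq_add_of_le (le_max_left k l)
    generalize max k l = N at *
    subst hd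
    have h2 : (S.comp k d).toStarHom (φ.toStarHom x) = y' :=
      ι.injective _ (by rw [ι.incl_comp, hx.1, hyy', hyb])
    rw [← h2, ← RigidEmbedding.comp_toStarHom] at hy'
    have hpos : 0 < ((S.comp k d).comp φ).mult :=
      ((S.comp_isUnital (fun l hl => hS.unital l (hk.trans hl)) d).comp hφ).mult_pos
        (S.dim_pos (k + d))
    exact (RigidEmbedding.toStarHom_mem_fourCycle_iff _ ⟨0, hpos⟩).1 hy'
  exact ⟨k', φ'.toStarHom x, φ'.toStarHom_mem_fourCycle h1, hx.2⟩

/-- After balanced stretches on both sides the multiplicity is the only invariant of the types. Any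
balanced `γ` joining the two ends then closes the square up to a block diagonal unitary, which
`exists_factor` absorbs. -/
theorem IsPartialIso.exists_extension (hS : S.IsDyadic K) (hT : T.IsDyadic K')
    (h : IsPartialIso ι ι' K K' R) (N : ℕ) :
    ∃ R', IsPartialIso ι ι' K K' R' ∧ R ⊆ R' ∧ ∀ x, ∃ b', (ι.incl N x, b') ∈ R' := by
  obtain ⟨n, k, k', φ, φ', hn, hk, hk', hφ, hφ', rfl⟩ := h
  obtain ⟨d, hd, hb, a, -, ha⟩ := hS.exists_balanced hk N
  -- The exponent `a + 2` leaves room for a summand of each type in `γ`.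
  obtain ⟨d', -, hb', a', haa', ha'⟩ := hT.exists_balanced hk' (a + 2)
  obtain ⟨γ, hγ, hγb⟩ := RigidEmbedding.exists_balanced ha ha' haa'
  have hu := S.comp_isUnital (fun l hl => hS.unital l (hk.trans hl)) d
  have hu' := T.comp_isUnital (fun l hl => hT.unital l (hk'.trans hl)) d'
  have hn0 : 0 < ∑ i, n i := Finset.sum_pos (fun i _ => hn i) Finset.univ_nonempty
  obtain ⟨γ', hγ', hfac⟩ := RigidEmbedding.exists_factor ((S.comp k d).comp φ) γ
    ((T.comp k' d').comp φ') (hu.comp hφ) hγ (by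
      intro g
      have h1 := (hγb.comp_left ((S.comp k d).comp φ)).four_mul_count g
      have h2 := (hb'.comp_left φ').four_mul_count g
      -- Both composites are unital between the same algebras, so total sizes fix the multiplicity.
      have h3 : (γ.comp ((S.comp k d).comp φ)).mult = ((T.comp k' d').comp φ').mult :=
        Nat.eq_of_mul_eq_mul_right hn0
          ((hγ.comp (hu.comp hφ)).mult_mul.trans (hu'.comp hφ').mult_mul.symm)
      omega)
  refine ⟨_, ⟨S.dim (k + d), k + d, k' + d', RigidEmbedding.refl _, γ', S.dim_pos _, by omega,
    by omega, RigidEmbedding.refl_isUnital, hγ', rfl⟩, ?_, fun x => ?_⟩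
  · rintro _ ⟨x, rfl⟩
    refine ⟨((S.comp k d).comp φ).toStarHom x, ?_⟩
    simp only [RigidEmbedding.refl_toStarHom, hfac]
    rw [RigidEmbedding.comp_toStarHom, RigidEmbedding.comp_toStarHom, ι.incl_comp, ι'.incl_comp]
  · obtain ⟨y, hy⟩ := ι.exists_incl_eq (show N ≤ k + d by omega) x
    refine ⟨ι'.incl (k' + d') (γ'.toStarHom y), y, ?_⟩
    simp only [RigidEmbedding.refl_toStarHom, hy]

variable (ι ι') in
theorem exists_isPartialIso (hS : S.IsDyadic K) (hT : T.IsDyadic K') :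
    ∃ R, IsPartialIso ι ι' K K' R := by
  obtain ⟨d, hd, hb, a, -, ha⟩ := hS.exists_balanced le_rfl 0
  obtain ⟨d', -, hb', a', haa', ha'⟩ := hT.exists_balanced le_rfl (a + 2)
  obtain ⟨γ, hγ, -⟩ := RigidEmbedding.exists_balanced ha ha' haa'
  exact ⟨_, S.dim (K + d), K + d, K' + d', RigidEmbedding.refl _, γ, S.dim_pos _, by omega,
    by omega, RigidEmbedding.refl_isUnital, hγ, rfl⟩

variable (ι ι') in
/-- Limits of dyadic systems are isomorphic, by an isomorphism matching the self-adjoint parts of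
the limits of the 4-cycle algebras. -/
theorem exists_starEquiv (hS : S.IsDyadic K) (hT : T.IsDyadic K') :
    ∃ σ : B ≃⋆ₐ[ℂ] B', σ '' ι.selfAdjointPart = ι'.selfAdjointPart := by
  -- Back and forth: one step absorbs stage `N` of both systems, the second by extending the swapped
  -- relation.
  have hstep : ∀ (R : {R // IsPartialIso ι ι' K K' R}) (N : ℕ),
      ∃ R' : {R // IsPartialIso ι ι' K K' R}, R.1 ⊆ R'.1 ∧
        (∀ x, ∃ b', (ι.incl N x, b') ∈ R'.1) ∧ ∀ x, ∃ b, (b, ι'.incl N x) ∈ R'.1 := by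
    rintro ⟨R, hR⟩ N
    obtain ⟨R₁, h₁, hRR₁, ht⟩ := hR.exists_extension hS hT N
    obtain ⟨R₂, h₂, hRR₂, ht'⟩ := h₁.swap.exists_extension hT hS N
    have hsub : R₁ ⊆ Prod.swap '' R₂ := by
      rintro ⟨a, b⟩ hab
      exact ⟨(b, a), hRR₂ ⟨(a, b), hab, rfl⟩, rfl⟩
    refine ⟨⟨_, h₂.swap⟩, hRR₁.trans hsub, fun x => ?_, fun x => ?_⟩
    · obtain ⟨b', hb'⟩ := ht x
      exact ⟨b', hsub hb'⟩
    · obtain ⟨b, hb⟩ := ht' x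
      exact ⟨b, ⟨_, hb, rfl⟩⟩
  choose next hnext using hstep
  obtain ⟨R₀, hR₀⟩ := exists_isPartialIso ι ι' hS hT
  let R : ℕ → {R // IsPartialIso ι ι' K K' R} :=
    fun i => Nat.rec ⟨R₀, hR₀⟩ (fun N R => next R N) i
  have hmono : Monotone fun i => (R i).1 := monotone_nat_of_le_succ fun i => (hnext (R i) i).1
  have hG := isStarRelation_iUnion hmono fun i => (R i).2.isStarRelation
  have hswap : ∀ i {b b'}, (b, b') ∈ (R i).1 → (b', b) ∈ Prod.swap '' (R i).1 :=
    fun i b b' h => ⟨_, h, rfl⟩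
  have hcommon : ∀ {a a' : B × B'}, a ∈ ⋃ i, (R i).1 → a' ∈ ⋃ i, (R i).1 →
      ∃ i, a ∈ (R i).1 ∧ a' ∈ (R i).1 := by
    intro a a' ha ha'
    obtain ⟨i, hi⟩ := Set.mem_iUnion.1 ha
    obtain ⟨j, hj⟩ := Set.mem_iUnion.1 ha'
    exact ⟨max i j, hmono (le_max_left i j) hi, hmono (le_max_right i j) hj⟩
  obtain ⟨σ, hσ⟩ := hG.exists_starEquiv (fun b => by
      obtain ⟨k, x, rfl⟩ := ι.exhausts b
      obtain ⟨b', hb'⟩ := (hnext (R k) k).2.1 x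
      exact ⟨b', Set.mem_iUnion.2 ⟨k + 1, hb'⟩⟩) (fun b b₁ b₂ h₁ h₂ => by
      obtain ⟨i, hi₁, hi₂⟩ := hcommon h₁ h₂
      exact (R i).2.eq_right hi₁ hi₂) (fun b => by
      obtain ⟨k, x, rfl⟩ := ι'.exhausts b
      obtain ⟨b', hb'⟩ := (hnext (R k) k).2.2 x
      exact ⟨b', Set.mem_iUnion.2 ⟨k + 1, hb'⟩⟩) (fun b₁ b₂ b h₁ h₂ => by
      obtain ⟨i, hi₁, hi₂⟩ := hcommon h₁ h₂
      exact (R i).2.swap.eq_right (hswap i hi₁) (hswap i hi₂))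
  -- It is enough to match the limit algebras themselves, since `σ` preserves adjoints.
  have hA : ∀ b, b ∈ ι.limitAlgebra ↔ σ b ∈ ι'.limitAlgebra := by
    intro b
    obtain ⟨i, hi⟩ := Set.mem_iUnion.1 (hσ b)
    exact ⟨(R i).2.mem_limitAlgebra hS hi, (R i).2.swap.mem_limitAlgebra hT (hswap i hi)⟩
  refine ⟨σ, Set.ext fun b' => ⟨?_, fun h => ⟨σ.symm b', ?_, by simp⟩⟩⟩
  · rintro ⟨b, hb, rfl⟩
    refine ⟨(hA b).1 hb.1, ?_⟩
    rw [← map_star]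
    exact (hA _).1 hb.2
  · refine ⟨(hA _).2 (by simpa using h.1), (hA _).2 ?_⟩
    rw [map_star]
    simpa using h.2

end Intertwining

/-! ### Homology -/

/-- The edge `13`. -/
def baseEdge : Edge := ⟨(0, 2), by decide⟩

/-- The coefficients of the fundamental cycle of the 4-cycle. -/
def edgeSign (e : Edge) : ℤ := if e.1 = (0, 2) ∨ e.1 = (1, 3) then 1 else -1

theorem boundary_apply (c : Edge →₀ ℤ) (v : Fin 4) :
    boundary c v = ∑ e, c e * ((if e.1.2 = v then 1 else 0) - if e.1.1 = v then 1 else 0) := by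
  rw [boundary, Finsupp.linearCombination_apply, Finsupp.sum_fintype _ _ (by simp),
    Finsupp.finsetSum_apply]
  simp [Finsupp.single_apply]

/-- Two edges meet at each vertex, so the cycle condition passes a coefficient on, up to sign,
around the 4-cycle. Hence `H₁` is infinite cyclic. -/
theorem H1_apply (c : H1) (e : Edge) : c.1 e = edgeSign e * c.1 baseEdge := by
  have h : ∀ v, boundary c.1 v = 0 := fun v => by rw [LinearMap.mem_ker.1 c.2]; rfl
  have hu : (Finset.univ : Finset Edge) = {⟨(0, 2), by decide⟩, ⟨(0, 3), by decide⟩,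
      ⟨(1, 2), by decide⟩, ⟨(1, 3), by decide⟩} := by decide
  simp only [boundary_apply, hu] at h
  have h0 := h 0
  have h1 := h 1
  have h2 := h 2
  simp [Finset.sum_insert] at h0 h1 h2
  have he : e ∈ (Finset.univ : Finset Edge) := Finset.mem_univ e
  rw [hu] at he
  simp only [Finset.mem_insert, Finset.mem_singleton] at he
  unfold baseEdge
  rcases he with rfl | rfl | rfl | rfl <;> simp [edgeSign] <;> linarith

theorem edgeMap_injective (g : D4Symmetry) : Function.Injective (edgeMap g) := by
  intro e e' h
  have h1 := congrArg (fun a : Edge => a.1.1) h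
  have h2 := congrArg (fun a : Edge => a.1.2) h
  exact Subtype.ext (Prod.ext (g.injective h1) (g.injective h2))

theorem edgeSign_edgeMap (g : D4Symmetry) (e : Edge) :
    edgeSign (edgeMap g e) = cycleSign g * edgeSign e := by
  obtain ⟨k, rfl⟩ := symmetry_surjective g
  revert k e
  decide

/-- A cycle is a multiple of `edgeSign`, which a symmetry reproduces up to the sign `cycleSign g`;
this sign is its own inverse. -/
theorem homologyOfSymmetry_apply (g : D4Symmetry) (c : H1) :
    homologyOfSymmetry g c = cycleSign g • c := by
  refine Subtype.ext (Finsupp.ext fun e' => ?_)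
  obtain ⟨e, rfl⟩ := (Finite.injective_iff_surjective.1 (edgeMap_injective g)) e'
  change Finsupp.mapDomain (edgeMap g) c.1 (edgeMap g e) = (cycleSign g • c.1) (edgeMap g e)
  rw [Finsupp.mapDomain_apply (edgeMap_injective g), Finsupp.smul_apply, H1_apply c e,
    H1_apply c (edgeMap g e), edgeSign_edgeMap, smul_eq_mul]
  have : cycleSign g * cycleSign g = 1 := by
    unfold cycleSign
    rcases moveSign_eq_or 0 g with h0 | h0 <;> rcases moveSign_eq_or 2 g with h2 | h2 <;>
      rw [h0, h2] <;> norm_num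
  linear_combination -(edgeSign e * c.1 baseEdge) * this

theorem RigidEmbedding.homology_apply {n m : Fin 4 → ℕ} (φ : RigidEmbedding n m) (c : H1) :
    φ.homology c = φ.charSum cycleSign • c := by
  rw [RigidEmbedding.homology, LinearMap.sum_apply, RigidEmbedding.charSum, Finset.sum_smul]
  simp only [homologyOfSymmetry_apply]

/-- The fundamental cycle of the 4-cycle. -/
def fundamentalCycle : H1 := ⟨Finsupp.equivFunOnFinite.symm edgeSign, by
  rw [LinearMap.mem_ker]
  ext v
  rw [boundary_apply]
  revert v
  simp only [Finsupp.equivFunOnFinite_symm_apply_apply, Finsupp.coe_zero, Pi.zero_apply]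
  decide⟩

theorem fundamentalCycle_ne_zero : fundamentalCycle ≠ 0 := by
  intro h
  have := congrArg (fun c : H1 => c.1 baseEdge) h
  revert this
  change edgeSign baseEdge ≠ 0
  decide

namespace RigidSystem

variable (S : RigidSystem)

theorem homologyMap_self (k : ℕ) : S.homologyMap k k le_rfl = LinearMap.id :=
  Nat.leRecOn_self _

theorem homologyMap_succ {k l : ℕ} (h : k ≤ l) :
    S.homologyMap k (l + 1) (Nat.le_succ_of_le h) = (S.emb l).homology ∘ₗ S.homologyMap k l h :=
  Nat.leRecOn_succ h _

theorem homologyMap_apply {k l : ℕ} (h : k ≤ l) (c : H1) :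
    S.homologyMap k l h c = (∏ i ∈ Finset.Ico k l, (S.emb i).charSum cycleSign) • c := by
  induction l, h using Nat.le_induction with
  | base => rw [homologyMap_self]; simp
  | succ l hl ih =>
    rw [homologyMap_succ S hl, LinearMap.comp_apply, ih, RigidEmbedding.homology_apply, smul_smul,
      Finset.prod_Ico_succ_top hl, mul_comm]

instance homologySystem : DirectedSystem (fun _ : ℕ => H1) (fun k l h => S.homologyMap k l h) where
  map_self k c := by rw [homologyMap_self]; rfl
  map_map k l m hkl hlm c := by
    rw [homologyMap_apply, homologyMap_apply, homologyMap_apply, smul_smul, mul_comm,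
      Finset.prod_Ico_consecutive _ hkl hlm]

/-- The connecting maps multiply by integers on a torsion-free group, so the fundamental cycle dies
in the limit only when some factor is zero. -/
theorem subsingleton_limitH1_iff :
    Subsingleton S.LimitH1 ↔ ∀ k, ∃ l, k ≤ l ∧ (S.emb l).charSum cycleSign = 0 := by
  constructor
  · intro hs k
    have h0 : Module.DirectLimit.of ℤ ℕ (fun _ : ℕ => H1) S.homologyMap k fundamentalCycle = 0 :=
      Subsingleton.elim _ _
    obtain ⟨l, hkl, hl⟩ := Module.DirectLimit.of.zero_exact h0
    rw [homologyMap_apply] at hl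
    have h1 := (smul_eq_zero.1 hl).resolve_right fundamentalCycle_ne_zero
    obtain ⟨i, hi, h2⟩ := Finset.prod_eq_zero_iff.1 h1
    exact ⟨i, (Finset.mem_Ico.1 hi).1, h2⟩
  · intro h
    refine ⟨fun a b => ?_⟩
    have key : ∀ a : S.LimitH1, a = 0 := by
      intro a
      induction a using Module.DirectLimit.induction_on with
      | ih k c =>
        obtain ⟨l, hkl, hl⟩ := h k
        rw [← Module.DirectLimit.of_f (hij := Nat.le_succ_of_le hkl), homologyMap_succ S hkl,
          LinearMap.comp_apply, RigidEmbedding.homology_apply, hl, zero_smul, map_zero]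
    rw [key a, key b]

end RigidSystem

/-! ### The dyadic matroid algebra -/

namespace DyadicMatroid

theorem dyadicMap_injective (k l : ℕ) (h : k ≤ l) : Function.Injective (dyadicMap k l h) := by
  intro x y hxy
  ext i j
  have hlt : ∀ i : Fin (2 ^ k), (i : ℕ) < 2 ^ l := fun i =>
    i.2.trans_le (Nat.pow_le_pow_right (by norm_num) h)
  have := congrFun (congrFun hxy ⟨i, hlt i⟩) ⟨j, hlt j⟩
  change repeatBlock k l x _ _ = repeatBlock k l y _ _ at this
  simpa [repeatBlock, Nat.div_eq_of_lt, Nat.mod_eq_of_lt] using this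

/-- The inclusion of `M_{2^k}` in the dyadic matroid algebra. -/
def of (k : ℕ) : Matrix (Fin (2 ^ k)) (Fin (2 ^ k)) ℂ →⋆ₙₐ[ℂ] DyadicMatroid where
  toFun x := Quotient.mk (DirectLimit.setoid dyadicMap) ⟨k, x⟩
  map_smul' c x := (DirectLimit.smul_def (f := dyadicMap) k x c).symm
  map_zero' := (DirectLimit.zero_def (f := dyadicMap) k).symm
  map_add' x y := (DirectLimit.add_def (f := dyadicMap) k x y).symm
  map_mul' x y := (DirectLimit.mul_def (f := dyadicMap) k x y).symm
  map_star' x := (DirectLimit.star_def (f := dyadicMap) k x).symm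

theorem of_one (k : ℕ) : of k 1 = 1 := (DirectLimit.one_def (f := dyadicMap) k).symm

theorem of_injective (k : ℕ) : Function.Injective (of k) :=
  DirectLimit.mk_injective _ dyadicMap_injective k

theorem of_dyadicMap {k l : ℕ} (h : k ≤ l) (x : Matrix (Fin (2 ^ k)) (Fin (2 ^ k)) ℂ) :
    of l (dyadicMap k l h x) = of k x := by
  have := DirectLimit.eq_of_le (f := dyadicMap) (Sigma.mk k x) l h
  exact this.symm

theorem exists_of (b : DyadicMatroid) : ∃ k x, of k x = b := by
  obtain ⟨k, x, h⟩ := DirectLimit.exists_eq_mk _ b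
  exact ⟨k, x, h.symm⟩

theorem exists_of_of_le {k l : ℕ} (h : k ≤ l) (x : Matrix (Fin (2 ^ k)) (Fin (2 ^ k)) ℂ) :
    ∃ y, of l y = of k x := ⟨_, of_dyadicMap h x⟩

theorem exists_of₂ (b c : DyadicMatroid) : ∃ k x y, of k x = b ∧ of k y = c := by
  obtain ⟨k, x, rfl⟩ := exists_of b
  obtain ⟨l, y, rfl⟩ := exists_of c
  exact ⟨max k l, _, _, of_dyadicMap (le_max_left k l) x, of_dyadicMap (le_max_right k l) y⟩

/-- The centre of the dyadic matroid algebra contains only the trivial idempotents. -/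
theorem eq_zero_or_one_of_central {z : DyadicMatroid} (hz : z * z = z) (hc : ∀ x, z * x = x * z) :
    z = 0 ∨ z = 1 := by
  obtain ⟨k, x, rfl⟩ := exists_of z
  rw [← map_mul] at hz
  have hx := of_injective k hz
  obtain ⟨c, rfl⟩ := Matrix.mem_range_scalar_of_commute_single (M := x) (fun i j _ => by
    have := hc (of k (Matrix.single i j 1))
    rw [← map_mul, ← map_mul] at this
    exact (of_injective k this).symm)
  rw [← map_mul] at hx
  have hc' : c * c = c := by
    have := congrFun (congrFun hx ⟨0, by positivity⟩) ⟨0, by positivity⟩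
    simpa using this
  rcases IsIdempotentElem.iff_eq_zero_or_one.1 hc' with rfl | rfl
  · left; rw [map_zero, map_zero]
  · right; rw [map_one, of_one]

end DyadicMatroid

/-! ### Tracial functionals and lifting -/

/-- Tracial functionals on a full matrix algebra are multiples of the trace. -/
theorem card_mul_tracial {I : Type*} [Fintype I] [DecidableEq I] (T : Matrix I I ℂ →ₗ[ℂ] ℂ)
    (hT : ∀ X Y, T (X * Y) = T (Y * X)) (X : Matrix I I ℂ) :
    (Fintype.card I : ℂ) * T X = Matrix.trace X * T 1 := by
  -- Averaging over matrix units replaces `X` by a scalar matrix, while a tracial functional sees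
  -- each inner sum as `X` itself.
  have h1 : ∑ i, ∑ j, Matrix.single i j 1 * X * Matrix.single j i 1 =
      Matrix.trace X • (1 : Matrix I I ℂ) := by
    have h : ∀ i j, Matrix.single i j 1 * X * Matrix.single j i 1 = X j j • Matrix.single i i 1 := by
      intro i j
      rw [Matrix.single_mul_mul_single]
      simp
    simp only [h, ← Finset.sum_smul]
    rw [← Finset.smul_sum, Matrix.sum_single_one]
    rfl
  have h2 := congrArg T h1
  rw [map_smul, smul_eq_mul] at h2
  rw [← h2, map_sum]
  clear h2
  have h3 : ∀ i, T (∑ j, Matrix.single i j 1 * X * Matrix.single j i 1) = T X := by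
    intro i
    rw [map_sum]
    have : ∀ j, T (Matrix.single i j 1 * X * Matrix.single j i 1) =
        T (X * Matrix.single j j 1) := by
      intro j
      rw [mul_assoc, hT, mul_assoc, Matrix.single_mul_single_same, mul_one]
    simp only [this]
    rw [← map_sum, ← Finset.mul_sum, Matrix.sum_single_one, mul_one]
  simp only [h3, Finset.sum_const, Finset.card_univ, nsmul_eq_mul]

/-- The trace of an idempotent is its rank. This integrality turns trace identities into
divisibility of sizes. -/
theorem exists_trace_eq_natCast {I : Type*} [Fintype I] [DecidableEq I] {X : Matrix I I ℂ}
    (hX : X * X = X) : ∃ r : ℕ, Matrix.trace X = r := by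
  have h : IsIdempotentElem (Matrix.toLin' X) := by
    rw [IsIdempotentElem, Module.End.mul_eq_comp, ← Matrix.toLin'_mul, hX]
  exact ⟨_, (Matrix.trace_toLin'_eq X).symm.trans
    (LinearMap.IsIdempotentElem.isProj_range _ h).trace⟩

section Lift

variable {M C D : Type*} [NonUnitalRing M] [StarRing M] [Module ℂ M]
  [NonUnitalRing C] [StarRing C] [Module ℂ C] [NonUnitalRing D] [StarRing D] [Module ℂ D]

theorem exists_lift (j : C →⋆ₙₐ[ℂ] D) (hj : Function.Injective j) (g : M →⋆ₙₐ[ℂ] D)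
    (h : ∀ x, ∃ y, j y = g x) : ∃ ρ : M →⋆ₙₐ[ℂ] C, ∀ x, j (ρ x) = g x := by
  choose ρ hρ using h
  exact ⟨{  toFun := ρ
            map_smul' := fun c x => hj (by
              rw [hρ, map_smul, MonoidHom.id_apply, map_smul, hρ])
            map_zero' := hj (by rw [hρ, map_zero, map_zero])
            map_add' := fun x y => hj (by rw [hρ, map_add, map_add, hρ, hρ])
            map_mul' := fun x y => hj (by rw [hρ, map_mul, map_mul, hρ, hρ])
            map_star' := fun x => hj (by rw [hρ, map_star, map_star, hρ]) }, hρ⟩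

/-- The linear map underlying a star homomorphism. -/
def starHomToLinear (f : M →⋆ₙₐ[ℂ] D) : M →ₗ[ℂ] D where
  toFun := f
  map_add' := map_add f
  map_smul' := map_smul f

end Lift

/-- A finite generating set lands in a single stage. Homomorphisms from matrix algebras into a limit
can thereby be lifted to a building block. -/
theorem exists_forall_mem_of_monotone {M D : Type*} [AddCommGroup M] [Module ℂ M]
    [Module.Finite ℂ M] [AddCommGroup D] [Module ℂ D] (g : M →ₗ[ℂ] D) {W : ℕ → Submodule ℂ D}
    (hW : Monotone W) (h : ∀ x, ∃ l, g x ∈ W l) (N : ℕ) : ∃ l, N ≤ l ∧ ∀ x, g x ∈ W l := by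
  obtain ⟨s, hs⟩ := (Module.Finite.fg_top : (⊤ : Submodule ℂ M).FG)
  choose l hl using h
  refine ⟨max N (s.sup l), le_max_left _ _, fun x => ?_⟩
  have : (⊤ : Submodule ℂ M) ≤ (W (max N (s.sup l))).comap g := by
    rw [← hs, Submodule.span_le]
    exact fun y hy => hW ((Finset.le_sup hy).trans (le_max_right _ _)) (hl y)
  exact this (Submodule.mem_top (x := x))

/-- If `a < b`, then `2 ^ (a + 1)` would divide both `2 ^ b` and the sum, hence `2 ^ a`. This makes
the two sides of a building block equal in size. -/
theorem eq_of_two_pow_add_two_pow {a b c : ℕ} (h : 2 ^ a + 2 ^ b = 2 ^ c) : a = b := by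
  have key : ∀ a b c : ℕ, a < b → 2 ^ a + 2 ^ b ≠ 2 ^ c := by
    intro a b c hab h
    have h1 : 2 ^ b < 2 ^ c := by
      have : 0 < 2 ^ a := by positivity
      omega
    have h2 : b < c := (Nat.pow_lt_pow_iff_right (by norm_num)).1 h1
    have h3 : 2 ^ (a + 1) ∣ 2 ^ b := pow_dvd_pow 2 hab
    have h4 : 2 ^ (a + 1) ∣ 2 ^ c := pow_dvd_pow 2 (by omega)
    rw [← h] at h4
    have h5 := (Nat.dvd_add_left h3).1 h4
    have h6 : a + 1 ≤ a := (Nat.pow_dvd_pow_iff_le_right (by norm_num)).1 h5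
    omega
  rcases lt_trichotomy a b with hab | hab | hab
  · exact absurd h (key a b c hab)
  · exact hab
  · exact absurd ((add_comm _ _).trans h) (key b a c hab)

/-! ### Systems giving inclusions of `F ⊕ F` in `F` -/

/-- The projection onto the two blocks on the side of the vertex `i`. -/
def sideProj (n : Fin 4 → ℕ) (i : Fin 4) : FullMatrix n := blockProj n i + blockProj n (mate i)

theorem isBlockDiagonal_sideProj (n : Fin 4 → ℕ) (i : Fin 4) : IsBlockDiagonal (sideProj n i) :=
  (isBlockDiagonal_blockProj i).add (isBlockDiagonal_blockProj (mate i))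

theorem sideProj_eq_diagonal (n : Fin 4 → ℕ) (i : Fin 4) :
    sideProj n i = Matrix.diagonal fun p => if p.1 = i ∨ p.1 = mate i then 1 else 0 := by
  rw [sideProj, blockProj, blockProj, Matrix.diagonal_add]
  congr 1
  ext p
  have := mate_ne i
  by_cases h : p.1 = i <;> by_cases h' : p.1 = mate i <;> simp_all

theorem IsBlockDiagonal.mul_sideProj {n : Fin 4 → ℕ} {x : FullMatrix n} (hx : IsBlockDiagonal x)
    (i : Fin 4) : x * sideProj n i = sideProj n i * x := by
  rw [sideProj, mul_add, add_mul, hx.mul_blockProj, hx.mul_blockProj]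

theorem sideProj_mul_self (n : Fin 4 → ℕ) (i : Fin 4) :
    sideProj n i * sideProj n i = sideProj n i := by
  rw [sideProj_eq_diagonal, Matrix.diagonal_mul_diagonal]
  congr 1
  ext p
  split_ifs <;> simp

theorem single_mul_sideProj {n : Fin 4 → ℕ} (i : Fin 4) (p : Idx n)
    (hp : p.1 = i ∨ p.1 = mate i) :
    Matrix.single p p (1 : ℂ) * sideProj n i = Matrix.single p p 1 := by
  rw [sideProj_eq_diagonal]
  ext a b
  rw [Matrix.mul_diagonal]
  by_cases h : b = p
  · subst h; rw [if_pos hp, mul_one]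
  · rw [Matrix.single_apply_of_col_ne _ _ (Ne.symm h), zero_mul]

theorem isBlockDiagonal_single {n : Fin 4 → ℕ} (p : Idx n) :
    IsBlockDiagonal (Matrix.single p p (1 : ℂ)) := by
  intro a b hab
  rw [Matrix.single_apply, if_neg]
  rintro ⟨rfl, rfl⟩
  exact hab rfl

theorem single_mul_single_self {n : Fin 4 → ℕ} (p : Idx n) :
    Matrix.single p p (1 : ℂ) * Matrix.single p p 1 = Matrix.single p p 1 := by
  rw [Matrix.single_mul_single_same, mul_one]

theorem sideProj_ne_zero {n : Fin 4 → ℕ} (hn : ∀ i, 0 < n i) (i : Fin 4) : sideProj n i ≠ 0 := by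
  intro h
  have := congrFun (congrFun h ⟨i, ⟨0, hn i⟩⟩) ⟨i, ⟨0, hn i⟩⟩
  rw [sideProj_eq_diagonal] at this
  simp at this

theorem exists_sideProj_mul_eq_zero (n : Fin 4 → ℕ) (i : Fin 4) :
    ∃ j, sideProj n i * sideProj n j = 0 := by
  have h : ∀ i : Fin 4, ∃ j, ∀ a : Fin 4, (a = i ∨ a = mate i) → ¬ (a = j ∨ a = mate j) := by
    decide
  obtain ⟨j, hj⟩ := h i
  refine ⟨j, ?_⟩
  rw [sideProj_eq_diagonal, sideProj_eq_diagonal, Matrix.diagonal_mul_diagonal,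
    ← Matrix.diagonal_zero]
  congr 1
  ext p
  by_cases hp : p.1 = i ∨ p.1 = mate i
  · rw [if_neg (hj p.1 hp), mul_zero]
  · rw [if_neg hp, zero_mul]

theorem blockTrace_sideProj (n : Fin 4 → ℕ) (i : Fin 4) :
    blockTrace i (sideProj n i) = n i ∧ blockTrace (mate i) (sideProj n i) = n (mate i) := by
  have h := mate_ne i
  rw [sideProj, blockTrace_add, blockTrace_add]
  simp only [blockTrace_blockProj]
  simp [h, Ne.symm h]

/-! ### Sides of the cycle under a rigid embedding -/

namespace RigidEmbedding

variable {n m : Fin 4 → ℕ}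

theorem symm_eq_or (g : D4Symmetry) (i : Fin 4) :
    (g.symm i = i ∧ g.symm (mate i) = mate i ∧ moveSign i g = 1) ∨
      (g.symm i = mate i ∧ g.symm (mate i) = i ∧ moveSign i g = -1) := by
  have hm := mate_ne i
  rcases symmetry_apply_eq_or g i with h | h
  · left
    refine ⟨?_, ?_, by simp [moveSign, h]⟩
    · conv_lhs => rw [← h]
      simp
    · conv_lhs => rw [← h, ← symmetry_mate]
      simp
  · right
    refine ⟨?_, ?_, by simp [moveSign, h, hm]⟩
    · conv_lhs => rw [← mate_mate i, ← h, ← symmetry_mate]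
      simp
    · conv_lhs => rw [← h]
      simp

/-- Symmetries preserve sides, so each isometry intertwines the side projections. Single block
projections are in general not preserved. -/
theorem IsUnital.toStarHom_sideProj {φ : RigidEmbedding n m} (hφ : φ.IsUnital) (i : Fin 4) :
    φ.toStarHom (sideProj n i) = sideProj m i := by
  have h : ∀ s, φ.V s * sideProj n i = sideProj m i * φ.V s := by
    intro s
    rw [sideProj, sideProj, Matrix.mul_add, Matrix.add_mul, blockProj_mul_V, blockProj_mul_V]
    rcases symm_eq_or (φ.type s) i with ⟨h1, h2, -⟩ | ⟨h1, h2, -⟩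
    · rw [h1, h2]
    · rw [h1, h2, add_comm]
  rw [isUnital_iff] at hφ
  rw [toStarHom_apply]
  simp only [h, Matrix.mul_assoc]
  rw [← Matrix.mul_sum, hφ, Matrix.mul_one]

theorem IsUnital.dim_add {φ : RigidEmbedding n m} (hφ : φ.IsUnital) (i : Fin 4) :
    m i + m (mate i) = φ.mult * (n i + n (mate i)) := by
  rw [hφ.dim_eq i, hφ.dim_eq (mate i), ← Finset.sum_add_distrib]
  have : ∀ s, n ((φ.type s).symm i) + n ((φ.type s).symm (mate i)) = n i + n (mate i) := by
    intro s
    rcases symm_eq_or (φ.type s) i with ⟨h1, h2, -⟩ | ⟨h1, h2, -⟩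
    · rw [h1, h2]
    · rw [h1, h2, add_comm]
  simp [this]

/-- The block traces of the images of diagonal matrix units on the side of `i`. -/
theorem blockTrace_toStarHom_single (φ : RigidEmbedding n m) (p q : Idx n)
    (hq : q.1 = mate p.1) :
    blockTrace p.1 (φ.toStarHom (Matrix.single q q 1)) =
        blockTrace (mate p.1) (φ.toStarHom (Matrix.single p p 1)) ∧
      blockTrace (mate p.1) (φ.toStarHom (Matrix.single q q 1)) =
        blockTrace p.1 (φ.toStarHom (Matrix.single p p 1)) ∧
      blockTrace p.1 (φ.toStarHom (Matrix.single p p 1)) +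
        blockTrace (mate p.1) (φ.toStarHom (Matrix.single p p 1)) = φ.mult ∧
      blockTrace p.1 (φ.toStarHom (Matrix.single p p 1)) -
        blockTrace (mate p.1) (φ.toStarHom (Matrix.single p p 1)) =
          φ.charSum (moveSign p.1) := by
  have hm := mate_ne p.1
  have hm' := Ne.symm hm
  simp only [blockTrace_toStarHom, blockTrace_single, hq, charSum, ← Finset.sum_add_distrib,
    ← Finset.sum_sub_distrib]
  refine ⟨Finset.sum_congr rfl fun s _ => ?_, Finset.sum_congr rfl fun s _ => ?_, ?_, ?_⟩
  · rcases symm_eq_or (φ.type s) p.1 with ⟨h1, h2, -⟩ | ⟨h1, h2, -⟩ <;> simp [h1, h2, hm, hm']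
  · rcases symm_eq_or (φ.type s) p.1 with ⟨h1, h2, -⟩ | ⟨h1, h2, -⟩ <;> simp [h1, h2, hm, hm']
  · rw [Finset.sum_congr rfl (g := fun _ => (1 : ℂ)), Finset.sum_const]
    · simp
    · intro s _
      rcases symm_eq_or (φ.type s) p.1 with ⟨h1, h2, -⟩ | ⟨h1, h2, -⟩ <;> simp [h1, h2, hm']
  · push_cast
    refine Finset.sum_congr rfl fun s _ => ?_
    rcases symm_eq_or (φ.type s) p.1 with ⟨h1, h2, h3⟩ | ⟨h1, h2, h3⟩ <;>
      simp [h1, h2, h3, hm']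

end RigidEmbedding

/-! ### Constraints on a system with limit `F` and self-adjoint part `F ⊕ F` -/

namespace RigidSystem

variable {S : RigidSystem}

/-- The unit of `F` lies in some building block; by injectivity it is the unit of that block and of
all later ones. -/
theorem Realization.exists_unital (ι : S.Realization DyadicMatroid) :
    ∃ K, ∀ k, K ≤ k → ι.incl k 1 = 1 ∧ (S.emb k).IsUnital := by
  obtain ⟨K, x, hx⟩ := ι.exhausts 1
  have key : ∀ k (y : FullMatrix (S.dim k)), ι.incl k y = 1 → y = 1 := by
    intro k y hy
    apply ι.injective k
    calc ι.incl k y = ι.incl k y * 1 := (mul_one _).symm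
      _ = ι.incl k y * ι.incl k 1 := by rw [hy, one_mul, one_mul, ← one_mul (ι.incl k 1), ← hy,
            ← map_mul, mul_one]
      _ = ι.incl k 1 := by rw [hy, one_mul]
  have h1 : ∀ k, K ≤ k → ι.incl k 1 = 1 := by
    intro k hk
    obtain ⟨y, hy⟩ := ι.exists_incl_eq hk x
    have h := key k y (hy.trans hx)
    rw [← h, hy, hx]
  refine ⟨K, fun k hk => ⟨h1 k hk, key _ _ ?_⟩⟩
  rw [ι.compatible, h1 k hk]

/-- The total size of a building block of a unital system in the dyadic matroid algebra divides a
power of two. -/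
theorem Realization.sum_dim_dvd (ι : S.Realization DyadicMatroid) {k : ℕ} (hk : ι.incl k 1 = 1) :
    ∃ j, ∑ i, S.dim k i ∣ 2 ^ j := by
  obtain ⟨j, -, hj⟩ := exists_forall_mem_of_monotone
    (starHomToLinear (ι.incl k))
    (W := fun j => LinearMap.range (starHomToLinear (DyadicMatroid.of j)))
    (by
      rintro a b hab _ ⟨x, rfl⟩
      exact ⟨_, DyadicMatroid.of_dyadicMap hab x⟩)
    (fun x => by
      obtain ⟨j, y, hy⟩ := DyadicMatroid.exists_of (ι.incl k x)
      exact ⟨j, y, hy⟩) 0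
  obtain ⟨ρ, hρ⟩ := exists_lift (DyadicMatroid.of j) (DyadicMatroid.of_injective j) (ι.incl k)
    fun x => hj x
  refine ⟨j, ?_⟩
  have hρ1 : ρ 1 = 1 := DyadicMatroid.of_injective j (by rw [hρ, hk, DyadicMatroid.of_one])
  let T : FullMatrix (S.dim k) →ₗ[ℂ] ℂ := Matrix.traceLinearMap (Fin (2 ^ j)) ℂ ℂ ∘ₗ
    starHomToLinear ρ
  have hTa : ∀ X, T X = Matrix.trace (ρ X) := fun _ => rfl
  let p : Idx (S.dim k) := ⟨0, ⟨0, S.dim_pos k 0⟩⟩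
  have h := card_mul_tracial T (fun X Y => by
    rw [hTa, hTa, map_mul, map_mul, Matrix.trace_mul_comm]) (Matrix.single p p 1)
  -- A minimal projection of the building block has rank `r` in `M_{2^j}`, so the total size times
  -- `r` is `2 ^ j`.
  obtain ⟨r, hr⟩ := exists_trace_eq_natCast (X := ρ (Matrix.single p p 1))
    (by rw [← map_mul, single_mul_single_self])
  rw [hTa, hTa, hρ1, hr, Matrix.trace_one, Matrix.trace_single_eq_same, one_mul, Fintype.card_fin,
    Fintype.card_sigma] at h
  simp only [Fintype.card_fin] at h
  exact ⟨r, by exact_mod_cast h.symm⟩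

variable {π : DyadicMatroid × DyadicMatroid →⋆ₙₐ[ℂ] DyadicMatroid}

theorem Realization.incl_sideProj (ι : S.Realization DyadicMatroid) {k l : ℕ}
    (hu : ∀ l, k ≤ l → (S.emb l).IsUnital) (h : k ≤ l) (i : Fin 4) :
    ι.incl l (sideProj _ i) = ι.incl k (sideProj _ i) := by
  obtain ⟨d, rfl⟩ := Nat.exists_eq_add_of_le h
  rw [← ι.incl_comp k d, (S.comp_isUnital hu d).toStarHom_sideProj]

/-- The corner of the self-adjoint part at one side of the 4-cycle is a copy of `F`. -/
theorem Realization.exists_corner (ι : S.Realization DyadicMatroid)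
    (hπ : Function.Injective π) (hr : Set.range π = ι.selfAdjointPart) {k : ℕ}
    (hu : ∀ l, k ≤ l → (S.emb l).IsUnital)
    (i : Fin 4) : ∃ ψ : DyadicMatroid →⋆ₙₐ[ℂ] DyadicMatroid, Function.Injective ψ ∧
      ψ 1 = ι.incl k (sideProj _ i) ∧ (∀ x, ψ x ∈ ι.selfAdjointPart) ∧
      ∀ a ∈ ι.selfAdjointPart, a * ι.incl k (sideProj _ i) = a → ∃ x, ψ x = a := by
  have hside : ∀ j, ∃ z, π z = ι.incl k (sideProj _ j) := by
    intro j
    have : ι.incl k (sideProj _ j) ∈ Set.range π := by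
      rw [hr, ι.mem_selfAdjointPart_iff]
      exact ⟨k, _, isBlockDiagonal_sideProj _ j, rfl⟩
    exact this
  obtain ⟨z, hz⟩ := hside i
  obtain ⟨j, hj⟩ := exists_sideProj_mul_eq_zero (S.dim k) i
  obtain ⟨w, hw⟩ := hside j
  have hzz : z * z = z := hπ (by rw [map_mul, hz, ← map_mul, sideProj_mul_self])
  have hne : ∀ i, ι.incl k (sideProj _ i) ≠ 0 := fun i h =>
    sideProj_ne_zero (S.dim_pos k) i (ι.injective k (h.trans (map_zero _).symm))
  -- Under unital embeddings the side projection is the same limit element at every stage, and it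
  -- commutes with block diagonal matrices, so `z` is central in `F ⊕ F`.
  have hc : ∀ x, z * x = x * z := by
    intro x
    apply hπ
    have hx : π x ∈ ι.selfAdjointPart := hr ▸ Set.mem_range_self x
    obtain ⟨l, y, hy, hyx⟩ := (ι.mem_selfAdjointPart_iff _).1 hx
    obtain ⟨y', hy', hyy'⟩ := ι.exists_incl_eq_of_isBlockDiagonal (le_max_right k l) hy
    rw [map_mul, map_mul, hz, ← hyx, ← hyy', ← ι.incl_sideProj hu (le_max_left k l), ← map_mul,
      ← map_mul, hy'.mul_sideProj]
  -- Each component of `z` is `0` or `1`. They are not both `0`, as the side is nonzero, nor both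
  -- `1`, as the other side is nonzero and orthogonal to it; so `z` is the unit of one summand `F`.
  have hz1 : z.1 = 0 ∨ z.1 = 1 := DyadicMatroid.eq_zero_or_one_of_central
    (congrArg Prod.fst hzz) fun x => congrArg Prod.fst (hc (x, 0))
  have hz2 : z.2 = 0 ∨ z.2 = 1 := DyadicMatroid.eq_zero_or_one_of_central
    (congrArg Prod.snd hzz) fun x => congrArg Prod.snd (hc (0, x))
  have hrange : ∀ x, π x ∈ ι.selfAdjointPart := fun x => hr ▸ Set.mem_range_self x
  have hmem : ∀ a ∈ ι.selfAdjointPart, a * ι.incl k (sideProj _ i) = a →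
      ∃ x, π x = a ∧ x * z = x := by
    intro a ha haz
    rw [← hr] at ha
    obtain ⟨x, rfl⟩ := ha
    exact ⟨x, rfl, hπ (by rw [map_mul, hz, haz])⟩
  rcases hz1 with h1 | h1 <;> rcases hz2 with h2 | h2
  · refine absurd ?_ (hne i)
    rw [← hz, show z = 0 from Prod.ext h1 h2, map_zero]
  · refine ⟨π.comp (NonUnitalStarAlgHom.inr ℂ DyadicMatroid DyadicMatroid), ?_, ?_,
      fun x => hrange _, fun a ha haz => ?_⟩
    · intro x y hxy
      exact congrArg Prod.snd (hπ hxy)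
    · rw [← hz]
      exact congrArg π (Prod.ext h1.symm h2.symm)
    · obtain ⟨x, rfl, hx⟩ := hmem a ha haz
      refine ⟨x.2, congrArg π (Prod.ext ?_ rfl)⟩
      have := congrArg Prod.fst hx
      rw [Prod.fst_mul, h1, mul_zero] at this
      exact this
  · refine ⟨π.comp (NonUnitalStarAlgHom.inl ℂ DyadicMatroid DyadicMatroid), ?_, ?_,
      fun x => hrange _, fun a ha haz => ?_⟩
    · intro x y hxy
      exact congrArg Prod.fst (hπ hxy)
    · rw [← hz]
      exact congrArg π (Prod.ext h1.symm h2.symm)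
    · obtain ⟨x, rfl, hx⟩ := hmem a ha haz
      refine ⟨x.1, congrArg π (Prod.ext rfl ?_)⟩
      have := congrArg Prod.snd hx
      rw [Prod.snd_mul, h2, mul_zero] at this
      exact this
  · refine absurd ?_ (hne j)
    have hzw : z * w = 0 := hπ (by rw [map_mul, hz, hw, ← map_mul, hj, map_zero, map_zero])
    rw [show z = 1 from Prod.ext h1 h2, one_mul] at hzw
    rw [← hw, hzw, map_zero]

/-- The image of the block diagonal matrices of a building block. -/
def Realization.diagonalPart (ι : S.Realization DyadicMatroid) (k : ℕ) :
    Submodule ℂ DyadicMatroid where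
  carrier := {b | ∃ x, IsBlockDiagonal x ∧ ι.incl k x = b}
  add_mem' := by
    rintro _ _ ⟨x, hx, rfl⟩ ⟨y, hy, rfl⟩
    exact ⟨x + y, hx.add hy, map_add _ _ _⟩
  zero_mem' := ⟨0, fun _ _ _ => rfl, map_zero _⟩
  smul_mem' := by
    rintro c _ ⟨x, hx, rfl⟩
    refine ⟨c • x, fun p q h => ?_, map_smul _ _ _⟩
    rw [Matrix.smul_apply, hx p q h, smul_zero]

/-- Comparison of traces: in a system giving an inclusion of `F ⊕ F`, the characters of the vertices
vanish along the system, and the sizes of the sides of the building blocks are dyadic. -/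
theorem Realization.moveSign_and_dim (ι : S.Realization DyadicMatroid)
    (hπ : Function.Injective π) (hr : Set.range π = ι.selfAdjointPart) {k : ℕ}
    (hu : ∀ l, k ≤ l → (S.emb l).IsUnital) (i : Fin 4) :
    (∃ d, (S.comp k d).charSum (moveSign i) = 0) ∧
      ∃ j, S.dim k i + S.dim k (mate i) ∣ 2 ^ j := by
  obtain ⟨ψ, hψ, hψ1, hψr, hψs⟩ := ι.exists_corner hπ hr hu i
  let p : Idx (S.dim k) := ⟨i, ⟨0, S.dim_pos k i⟩⟩
  let q : Idx (S.dim k) := ⟨mate i, ⟨0, S.dim_pos k (mate i)⟩⟩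
  have hex : ∀ p : Idx (S.dim k), p.1 = i ∨ p.1 = mate i →
      ∃ f, ψ f = ι.incl k (Matrix.single p p 1) := fun p hp => hψs _
    ((ι.mem_selfAdjointPart_iff _).2 ⟨k, _, isBlockDiagonal_single p, rfl⟩)
    (by rw [← map_mul, single_mul_sideProj i p hp])
  obtain ⟨f, hf⟩ := hex p (Or.inl rfl)
  obtain ⟨g, hg⟩ := hex q (Or.inr rfl)
  -- Minimal projections from the two blocks of the side come from one `M_{2^j}`, which in turn
  -- lands in the block diagonal part of a later stage `l`.
  obtain ⟨j, f, g, rfl, rfl⟩ := DyadicMatroid.exists_of₂ f g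
  let ψj := ψ.comp (DyadicMatroid.of j)
  obtain ⟨l, hkl, hl⟩ := exists_forall_mem_of_monotone
    (starHomToLinear ψj) (W := ι.diagonalPart)
    (by
      rintro a b hab _ ⟨x, hx, rfl⟩
      exact ι.exists_incl_eq_of_isBlockDiagonal hab hx)
    (fun x => (ι.mem_selfAdjointPart_iff _).1 (hψr _)) k
  obtain ⟨ρ, hρ⟩ := exists_lift (ι.incl l) (ι.injective l) ψj fun x => by
    obtain ⟨y, -, hy⟩ := hl x
    exact ⟨y, hy⟩
  have hρd : ∀ x, IsBlockDiagonal (ρ x) := by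
    intro x
    obtain ⟨y, hy, hyx⟩ := hl x
    rwa [show ρ x = y from ι.injective l ((hρ x).trans hyx.symm)]
  have hρ1 : ρ 1 = sideProj _ i := ι.injective l (by
    rw [hρ, ι.incl_sideProj hu hkl, ← hψ1, ← DyadicMatroid.of_one j]
    rfl)
  obtain ⟨d, rfl⟩ := Nat.exists_eq_add_of_le hkl
  have hρf : ρ f = (S.comp k d).toStarHom (Matrix.single p p 1) :=
    ι.injective _ (by rw [hρ, ι.incl_comp, ← hf]; rfl)
  have hρg : ρ g = (S.comp k d).toStarHom (Matrix.single q q 1) :=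
    ι.injective _ (by rw [hρ, ι.incl_comp, ← hg]; rfl)
  -- Pulled back along `ρ`, each block trace is tracial on a full matrix algebra, hence a multiple
  -- of the trace.
  have htr : ∀ b X, (2 ^ j : ℂ) * blockTrace b (ρ X) =
      Matrix.trace X * blockTrace b (sideProj (S.dim (k + d)) i) := by
    intro b X
    let T : Matrix (Fin (2 ^ j)) (Fin (2 ^ j)) ℂ →ₗ[ℂ] ℂ :=
      { toFun := fun X => blockTrace b (ρ X)
        map_add' := fun X Y => by rw [map_add, blockTrace_add]
        map_smul' := fun c X => by rw [map_smul, blockTrace_smul]; rfl }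
    have h := card_mul_tracial T (fun X Y => by
      change blockTrace b (ρ (X * Y)) = blockTrace b (ρ (Y * X))
      rw [map_mul, map_mul, (hρd X).blockTrace_mul_comm]) X
    rw [Fintype.card_fin] at h
    rw [← hρ1]
    exact_mod_cast h
  have hff : f * f = f := DyadicMatroid.of_injective j (hψ (by
    rw [map_mul, map_mul, hf, ← map_mul, single_mul_single_self]))
  obtain ⟨r, hr⟩ := exists_trace_eq_natCast hff
  obtain ⟨b1, b2, b3, b4⟩ := (S.comp k d).blockTrace_toStarHom_single p q rfl
  have e1 := htr i f
  have e2 := htr (mate i) f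
  have e3 := htr i g
  have e4 := htr (mate i) g
  rw [hρf] at e1 e2
  rw [hρg] at e3 e4
  change blockTrace i _ = blockTrace (mate i) _ at b1
  change blockTrace (mate i) _ = blockTrace i _ at b2
  change blockTrace i _ + blockTrace (mate i) _ = _ at b3
  change blockTrace i _ - blockTrace (mate i) _ = _ at b4
  rw [(blockTrace_sideProj _ i).1] at e1 e3
  rw [(blockTrace_sideProj _ i).2] at e2 e4
  rw [b1] at e3
  rw [b2] at e4
  have hcu := S.comp_isUnital hu d
  have hdim := hcu.dim_add i
  have hmult := hcu.mult_pos (S.dim_pos (k + d))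
  have hpos : (S.dim (k + d) i + S.dim (k + d) (mate i) : ℂ) ≠ 0 := by
    have := S.dim_pos (k + d) i
    exact_mod_cast (by omega : S.dim (k + d) i + S.dim (k + d) (mate i) ≠ 0)
  -- For `p` and for `q` the two block traces of the image add up to the multiplicity.
  have htt : Matrix.trace f = Matrix.trace g := by
    apply mul_right_cancel₀ hpos
    linear_combination e3 + e4 - e1 - e2
  refine ⟨⟨d, ?_⟩, j, r, ?_⟩
  -- As `f` and `g` have equal trace, the images of `p` and `q` have equal `i`-th block trace. That
  -- of `q` is the `mate i`-th of `p`, so the two block traces of `p` agree, and their difference is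
  -- the character sum.
  · rw [htt] at e1
    have h2 : (2 ^ j : ℂ) ≠ 0 := pow_ne_zero _ two_ne_zero
    have : (((S.comp k d).charSum (moveSign i) : ℤ) : ℂ) = 0 := by
      rw [← b4, sub_eq_zero]
      exact mul_left_cancel₀ h2 (e1.trans e3.symm)
    exact_mod_cast this
  · have hd : (S.dim (k + d) i + S.dim (k + d) (mate i) : ℂ) =
        (S.comp k d).mult * (S.dim k i + S.dim k (mate i)) := by exact_mod_cast hdim
    have hm0 : ((S.comp k d).mult : ℂ) ≠ 0 := by exact_mod_cast hmult.ne'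
    have : (2 ^ j : ℂ) = (S.dim k i + S.dim k (mate i)) * r := by
      apply mul_left_cancel₀ hm0
      rw [hr] at e1 e2
      linear_combination e1 + e2 - (2 ^ j : ℂ) * b3 + (r : ℂ) * hd
    exact_mod_cast this

/-- A system with zero limit homology which gives an inclusion of `F ⊕ F` in `F` is dyadic. -/
theorem exists_isDyadic (h : IsGivenBy π S) (hS : Subsingleton S.LimitH1) :
    ∃ K, S.IsDyadic K := by
  obtain ⟨hπ, ι, hr⟩ := h
  obtain ⟨K, hK⟩ := ι.exists_unital
  have hu : ∀ k, K ≤ k → ∀ l, k ≤ l → (S.emb l).IsUnital := fun k hk l hl => (hK l (hk.trans hl)).2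
  have hsign : ∀ i k, ∃ l, k ≤ l ∧ (S.emb l).charSum (moveSign i) = 0 := by
    intro i k
    obtain ⟨d, hd⟩ := (ι.moveSign_and_dim hπ hr (hu (max K k) (le_max_left K k)) i).1
    rw [S.comp_charSum _ _ _ (moveSign_trans i) (by simp [moveSign])] at hd
    obtain ⟨e, -, he⟩ := Finset.prod_eq_zero_iff.1 hd
    exact ⟨_, (le_max_right K k).trans (Nat.le_add_right _ e), he⟩
  refine ⟨K, fun k hk => (hK k hk).2, fun k hk => ?_, hsign 0, hsign 2,
    (S.subsingleton_limitH1_iff).1 hS⟩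
  obtain ⟨j0, h0⟩ := (ι.moveSign_and_dim hπ hr (hu k hk) 0).2
  obtain ⟨j2, h2⟩ := (ι.moveSign_and_dim hπ hr (hu k hk) 2).2
  obtain ⟨j, h⟩ := ι.sum_dim_dvd (hK k hk).1
  obtain ⟨a, -, ha⟩ := (Nat.dvd_prime_pow Nat.prime_two).1 h0
  obtain ⟨b, -, hb⟩ := (Nat.dvd_prime_pow Nat.prime_two).1 h2
  obtain ⟨c, -, hc⟩ := (Nat.dvd_prime_pow Nat.prime_two).1 h
  change S.dim k 0 + S.dim k 1 = _ at ha
  change S.dim k 2 + S.dim k 3 = _ at hb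
  rw [Fin.sum_univ_four] at hc
  have hab : a = b := eq_of_two_pow_add_two_pow (c := c) (by omega)
  exact ⟨a, ha, by rw [hb, hab]⟩

end RigidSystem

/-! ### The stationary system -/

/-- The splitting of the coordinates of `M_{2^{a+2}}` into four copies of those of `M_{2^a}`. -/
def quarterEquiv (a : ℕ) : Fin 4 × Fin (2 ^ a) ≃ Fin (2 ^ (a + 2)) :=
  finProdFinEquiv.trans (finCongr (by rw [pow_add, mul_comm]; norm_num))

theorem dyadicMap_quarterEquiv (a : ℕ) (x : Matrix (Fin (2 ^ a)) (Fin (2 ^ a)) ℂ) (s t : Fin 4)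
    (i j : Fin (2 ^ a)) :
    dyadicMap a (a + 2) (Nat.le_add_right a 2) x (quarterEquiv a (s, i)) (quarterEquiv a (t, j)) =
      if s = t then x i j else 0 := by
  have hK : 0 < 2 ^ a := by positivity
  have hval : ∀ (s : Fin 4) (i : Fin (2 ^ a)), (quarterEquiv a (s, i) : ℕ) = i + 2 ^ a * s :=
    fun _ _ => rfl
  change repeatBlock a (a + 2) x _ _ = _
  simp only [repeatBlock, Matrix.of_apply, hval, Nat.add_mul_div_left _ _ hK,
    Nat.add_mul_mod_self_left, Nat.div_eq_of_lt (Fin.is_lt _), Nat.mod_eq_of_lt (Fin.is_lt _),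
    zero_add, Fin.val_inj, Fin.eta]

/-- The coordinates of the four summands of the stationary embedding. -/
def stationaryEquiv (k : ℕ) : Fin 4 × Idx (fun _ => 4 ^ k) ≃ Idx (fun _ => 4 ^ (k + 1)) :=
  Equiv.ofBijective (fun a => ⟨symmetry a.1 a.2.1, ⟨position a.1 a.2.1 * 4 ^ k + a.2.2, by
    have h1 : ((position a.1 a.2.1 : ℕ) + 1) * 4 ^ k ≤ 4 * 4 ^ k :=
      Nat.mul_le_mul_right _ (position a.1 a.2.1).2
    have h2 := a.2.2.2
    rw [pow_succ]
    linarith [add_mul (position a.1 a.2.1 : ℕ) 1 (4 ^ k)]⟩⟩) (by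
    have hK : 0 < 4 ^ k := by positivity
    rw [Fintype.bijective_iff_injective_and_card]
    constructor
    · rintro ⟨s, i, r⟩ ⟨t, j, r'⟩ h
      rw [Sigma.mk.injEq] at h
      obtain ⟨h1, h2⟩ := h
      have h2 := congrArg Fin.val (eq_of_heq h2)
      simp only at h1 h2
      have h3 : position s i = position t j := by
        have := congrArg (· / 4 ^ k) h2
        simp only [mul_comm _ (4 ^ k), Nat.mul_add_div hK, Nat.div_eq_of_lt r.2,
          Nat.div_eq_of_lt r'.2, add_zero] at this
        exact Fin.ext this
      obtain ⟨rfl, rfl⟩ := position_injective s t i j h1 h3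
      simp only [add_right_inj] at h2
      rw [Fin.ext h2]
    · simp [pow_succ]
      ring)

theorem stationaryEquiv_fst (k : ℕ) (s : Fin 4) (q : Idx fun _ => 4 ^ k) :
    (stationaryEquiv k (s, q)).1 = symmetry s q.1 := rfl

theorem stationaryV_eq (k : ℕ) (s : Fin 4) (p : Idx fun _ => 4 ^ (k + 1))
    (q : Idx fun _ => 4 ^ k) :
    stationaryV k s p q = if p = stationaryEquiv k (s, q) then 1 else 0 := by
  rw [stationaryV, Matrix.of_apply]
  congr 1
  rw [eq_iff_iff]
  obtain ⟨i, r⟩ := p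
  constructor
  · rintro ⟨h1, h2⟩
    obtain rfl : i = _ := h1
    change (r : ℕ) = _ at h2
    exact Sigma.ext rfl (heq_of_eq (Fin.ext h2))
  · intro h
    rw [h]
    exact ⟨rfl, rfl⟩

theorem stationaryEmbedding_apply (k : ℕ) (x : FullMatrix fun _ => 4 ^ k) (s t : Fin 4)
    (p q : Idx fun _ => 4 ^ k) :
    (stationaryEmbedding k).toStarHom x (stationaryEquiv k (s, p)) (stationaryEquiv k (t, q)) =
      if s = t then x p q else 0 :=
  (stationaryEmbedding k).toStarHom_apply_of_equiv (stationaryEquiv k) (stationaryV_eq k) x s t p q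

theorem stationaryEmbedding_isUnital (k : ℕ) : (stationaryEmbedding k).IsUnital :=
  (stationaryEmbedding k).isUnital_of_equiv (stationaryEquiv k) (stationaryV_eq k)

theorem stationarySystem_isDyadic : stationarySystem.IsDyadic 0 where
  unital k _ := stationaryEmbedding_isUnital k
  dim_add k _ := by
    have h : 4 ^ k + 4 ^ k = 2 ^ (2 * k + 1) := by
      rw [pow_succ, pow_mul]; norm_num; ring
    exact ⟨2 * k + 1, h, h⟩
  moveSign_zero k := ⟨k, le_rfl, by
    change ∑ s : Fin 4, moveSign 0 (symmetry s) = 0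
    decide⟩
  moveSign_two k := ⟨k, le_rfl, by
    change ∑ s : Fin 4, moveSign 2 (symmetry s) = 0
    decide⟩
  cycleSign k := ⟨k, le_rfl, by
    change ∑ s : Fin 4, FourCycle.cycleSign (symmetry s) = 0
    decide⟩

theorem stationarySystem_isGeneric : stationarySystem.IsGeneric :=
  fun N => ⟨N, le_rfl, symmetry_surjective⟩

/-! ### A realisation of the stationary system in `F` -/

/-- Coordinates identifying the building blocks of the stationary system with those of `F`. -/
def stationaryCoord : ∀ k : ℕ, Idx (fun _ => 4 ^ k) ≃ Fin (2 ^ (2 * k + 2))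
  | 0 => Fintype.equivFinOfCardEq (by simp)
  | k + 1 => (stationaryEquiv k).symm.trans
      (((Equiv.refl (Fin 4)).prodCongr (stationaryCoord k)).trans (quarterEquiv (2 * k + 2)))

theorem stationaryCoord_succ (k : ℕ) (s : Fin 4) (q : Idx fun _ => 4 ^ k) :
    stationaryCoord (k + 1) (stationaryEquiv k (s, q)) =
      quarterEquiv (2 * k + 2) (s, stationaryCoord k q) := by
  simp [stationaryCoord]

/-- Reindexing of matrices as a star homomorphism. -/
def reindexStarHom {I J : Type*} [Fintype I] [Fintype J] (e : I ≃ J) :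
    Matrix I I ℂ →⋆ₙₐ[ℂ] Matrix J J ℂ where
  toFun x := x.submatrix e.symm e.symm
  map_smul' _ _ := rfl
  map_zero' := rfl
  map_add' _ _ := rfl
  map_mul' x y := (Matrix.submatrix_mul_equiv x y e.symm e.symm e.symm).symm
  map_star' _ := rfl

theorem reindexStarHom_apply {I J : Type*} [Fintype I] [Fintype J] (e : I ≃ J)
    (x : Matrix I I ℂ) (i j : I) : reindexStarHom e x (e i) (e j) = x i j := by
  change x (e.symm (e i)) (e.symm (e j)) = x i j
  simp

theorem reindexStarHom_one {I J : Type*} [Fintype I] [Fintype J] [DecidableEq I] [DecidableEq J]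
    (e : I ≃ J) : reindexStarHom e 1 = 1 :=
  Matrix.submatrix_one_equiv e.symm

theorem reindexStarHom_injective {I J : Type*} [Fintype I] [Fintype J] (e : I ≃ J) :
    Function.Injective (reindexStarHom e) := by
  intro x y h
  ext i j
  rw [← reindexStarHom_apply e x, h, reindexStarHom_apply]

/-- The total size is `4 * 4 ^ k = 2 ^ (2 * k + 2)`. Ordering the coordinates by summand first makes
the embedding a fourfold repetition, which is two steps of the dyadic system. -/
theorem reindex_stationaryEmbedding (k : ℕ) (x : FullMatrix fun _ => 4 ^ k) :
    reindexStarHom (stationaryCoord (k + 1)) ((stationaryEmbedding k).toStarHom x) =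
      dyadicMap (2 * k + 2) (2 * k + 2 + 2) (Nat.le_add_right _ 2)
        (reindexStarHom (stationaryCoord k) x) := by
  ext i j
  obtain ⟨⟨s, i⟩, rfl⟩ := (quarterEquiv (2 * k + 2)).surjective i
  obtain ⟨⟨t, j⟩, rfl⟩ := (quarterEquiv (2 * k + 2)).surjective j
  obtain ⟨p, rfl⟩ := (stationaryCoord k).surjective i
  obtain ⟨q, rfl⟩ := (stationaryCoord k).surjective j
  refine Eq.trans ?_ (dyadicMap_quarterEquiv (2 * k + 2) (reindexStarHom (stationaryCoord k) x)
    s t (stationaryCoord k p) (stationaryCoord k q)).symm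
  refine Eq.trans (congrArg₂
    (reindexStarHom (stationaryCoord (k + 1)) ((stationaryEmbedding k).toStarHom x))
    (stationaryCoord_succ k s p).symm (stationaryCoord_succ k t q).symm) ?_
  rw [reindexStarHom_apply (stationaryCoord k)]
  exact (reindexStarHom_apply (stationaryCoord (k + 1)) _ _ _).trans
    (stationaryEmbedding_apply k x s t p q)

/-- The realisation of the limit of the stationary system as the dyadic matroid algebra. -/
def stationaryRealization : stationarySystem.Realization DyadicMatroid where
  incl k := (DyadicMatroid.of (2 * k + 2)).comp (reindexStarHom (stationaryCoord k))
  injective k := (DyadicMatroid.of_injective _).comp (reindexStarHom_injective _)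
  compatible k x := by
    change DyadicMatroid.of (2 * k + 2 + 2)
      (reindexStarHom (stationaryCoord (k + 1)) ((stationaryEmbedding k).toStarHom x)) =
        DyadicMatroid.of (2 * k + 2) (reindexStarHom (stationaryCoord k) x)
    rw [← DyadicMatroid.of_dyadicMap (Nat.le_add_right (2 * k + 2) 2)]
    congr 1
    exact reindex_stationaryEmbedding k x
  exhausts b := by
    obtain ⟨k, x, rfl⟩ := DyadicMatroid.exists_of b
    obtain ⟨y, hy⟩ := DyadicMatroid.exists_of_of_le (show k ≤ 2 * k + 2 by omega) x
    refine ⟨k, reindexStarHom (stationaryCoord k).symm y, ?_⟩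
    rw [← hy]
    change DyadicMatroid.of (2 * k + 2) _ = _
    congr 1
    ext i j
    change y (stationaryCoord k ((stationaryCoord k).symm i))
      (stationaryCoord k ((stationaryCoord k).symm j)) = y i j
    simp

/-! ### The self-adjoint part of the stationary limit -/

/-- The side of a vertex of the 4-cycle. -/
def side (i : Fin 4) : Fin 2 := if (i : ℕ) < 2 then 0 else 1

/-- For each vertex `i`, an enumeration of the symmetries which records the image of `i`. -/
def orbitCode : Fin 4 → Fin 4 → Fin 4 := ![![0, 1, 2, 3], ![2, 3, 0, 1], ![0, 2, 1, 3], ![2, 0, 3, 1]]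

theorem orbitCode_bijective (i : Fin 4) : Function.Bijective (orbitCode i) := by
  revert i; decide

/-- Each vertex of a side owns two codes, the same from either starting vertex. Coordinates on one
side with equal code thus lie in the same block. -/
theorem symmetry_eq_of_orbitCode_eq : ∀ i j s t : Fin 4, side i = side j →
    orbitCode i s = orbitCode j t → symmetry s i = symmetry t j := by
  decide

theorem side_symmetry (s i : Fin 4) : side (symmetry s i) = side i := by
  revert s i; decide

/-- Coordinates identifying each half of the self-adjoint part of a building block of the stationary
system with a subalgebra of `M_{2^{2k+1}}`. -/
def halfCoord : ∀ k : ℕ, Idx (fun _ => 4 ^ k) ≃ Fin 2 × Fin (2 ^ (2 * k + 1))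
  -- Blocks have size `4 ^ 0 = 1`, so a coordinate is just a vertex, determined by its side and
  -- parity.
  | 0 => Equiv.ofBijective (fun p => (side p.1, if (p.1 : ℕ) % 2 = 0 then 0 else 1)) (by
      rw [Fintype.bijective_iff_injective_and_card]
      refine ⟨?_, by simp⟩
      have key : ∀ i j : Fin 4, (side i, (if (i : ℕ) % 2 = 0 then 0 else 1 : Fin (2 ^ (2 * 0 + 1)))) =
          (side j, if (j : ℕ) % 2 = 0 then 0 else 1) → i = j := by decide
      rintro ⟨i, r⟩ ⟨j, r'⟩ h
      obtain rfl := key i j h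
      have : Subsingleton (Fin (4 ^ 0)) := by rw [pow_zero]; infer_instance
      rw [Subsingleton.elim r r'])
  | k + 1 => (stationaryEquiv k).symm.trans
      { toFun := fun a => ((halfCoord k a.2).1,
          quarterEquiv (2 * k + 1) (orbitCode a.2.1 a.1, (halfCoord k a.2).2))
        invFun := fun b =>
          let q := (halfCoord k).symm (b.1, ((quarterEquiv (2 * k + 1)).symm b.2).2)
          ((Equiv.ofBijective _ (orbitCode_bijective q.1)).symm
            ((quarterEquiv (2 * k + 1)).symm b.2).1, q)
        left_inv := by
          rintro ⟨s, q⟩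
          simp only [Equiv.symm_apply_apply, Prod.mk.eta, Prod.mk.injEq, and_true]
          exact (Equiv.ofBijective _ (orbitCode_bijective q.1)).symm_apply_apply s
        right_inv := by
          rintro ⟨c, j⟩
          have := fun q : Idx (fun _ => 4 ^ k) =>
            (Equiv.ofBijective _ (orbitCode_bijective q.1)).apply_symm_apply
              ((quarterEquiv (2 * k + 1)).symm j).1
          simp only [Equiv.ofBijective_apply] at this
          simp only [Equiv.apply_symm_apply, this, Prod.mk.eta] }

theorem halfCoord_succ (k : ℕ) (s : Fin 4) (q : Idx fun _ => 4 ^ k) :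
    halfCoord (k + 1) (stationaryEquiv k (s, q)) =
      ((halfCoord k q).1, quarterEquiv (2 * k + 1) (orbitCode q.1 s, (halfCoord k q).2)) := by
  simp [halfCoord]

theorem halfCoord_fst (k : ℕ) (p : Idx fun _ => 4 ^ k) : (halfCoord k p).1 = side p.1 := by
  induction k with
  | zero => rfl
  | succ k ih =>
    obtain ⟨⟨s, q⟩, rfl⟩ := (stationaryEquiv k).surjective p
    rw [halfCoord_succ, ih, stationaryEquiv_fst, side_symmetry]

/-- The compression of a matrix to one side of the 4-cycle. -/
def half (k : ℕ) (c : Fin 2) (a : FullMatrix fun _ => 4 ^ k) :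
    Matrix (Fin (2 ^ (2 * k + 1))) (Fin (2 ^ (2 * k + 1))) ℂ :=
  a.submatrix (fun j => (halfCoord k).symm (c, j)) fun j => (halfCoord k).symm (c, j)

theorem half_mul {k : ℕ} (c : Fin 2) {a : FullMatrix fun _ => 4 ^ k} (ha : IsBlockDiagonal a)
    (b : FullMatrix fun _ => 4 ^ k) : half k c (a * b) = half k c a * half k c b := by
  ext i j
  simp only [half, Matrix.submatrix_apply, Matrix.mul_apply]
  rw [← (halfCoord k).symm.sum_comp, Fintype.sum_prod_type, Finset.sum_eq_single c]
  · intro c' _ hc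
    refine Finset.sum_eq_zero fun z _ => ?_
    rw [ha, zero_mul]
    intro h
    have := congrArg side h
    rw [← halfCoord_fst, ← halfCoord_fst] at this
    simp at this
    exact hc this.symm
  · simp

theorem half_one (k : ℕ) (c : Fin 2) : half k c 1 = 1 :=
  Matrix.submatrix_one _ fun i j h => by simpa using h

theorem eq_of_half_eq {k : ℕ} {a b : FullMatrix fun _ => 4 ^ k} (ha : IsBlockDiagonal a)
    (hb : IsBlockDiagonal b) (h : ∀ c, half k c a = half k c b) : a = b := by
  ext p q
  by_cases hpq : p.1 = q.1
  · have h1 := congrFun (congrFun (h (halfCoord k p).1) (halfCoord k p).2) (halfCoord k q).2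
    have h2 : (halfCoord k p).1 = (halfCoord k q).1 := by rw [halfCoord_fst, halfCoord_fst, hpq]
    simp only [half, Matrix.submatrix_apply, Prod.mk.eta, Equiv.symm_apply_apply] at h1
    rwa [h2, Prod.mk.eta, Equiv.symm_apply_apply] at h1
  · rw [ha p q hpq, hb p q hpq]

/-- For a fixed vertex the code determines the summand. Between different vertices a code may match
across summands, but there the entries of a block diagonal `a` vanish. -/
theorem half_stationaryEmbedding {k : ℕ} (c : Fin 2) {a : FullMatrix fun _ => 4 ^ k}
    (ha : IsBlockDiagonal a) :
    half (k + 1) c ((stationaryEmbedding k).toStarHom a) =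
      dyadicMap (2 * k + 1) (2 * k + 1 + 2) (Nat.le_add_right _ 2) (half k c a) := by
  have key : ∀ m j, ∃ s q, (halfCoord k).symm (c, j) = q ∧ orbitCode q.1 s = m ∧
      (halfCoord (k + 1)).symm (c, quarterEquiv (2 * k + 1) (m, j)) = stationaryEquiv k (s, q) := by
    intro m j
    obtain ⟨s, hs⟩ := (orbitCode_bijective ((halfCoord k).symm (c, j)).1).2 m
    refine ⟨s, _, rfl, hs, ?_⟩
    rw [Equiv.symm_apply_eq, halfCoord_succ, hs, Equiv.apply_symm_apply]
  ext i j
  obtain ⟨⟨m, i⟩, rfl⟩ := (quarterEquiv (2 * k + 1)).surjective i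
  obtain ⟨⟨m', j⟩, rfl⟩ := (quarterEquiv (2 * k + 1)).surjective j
  obtain ⟨s, q, hq, hm, hsq⟩ := key m i
  obtain ⟨s', q', hq', hm', hsq'⟩ := key m' j
  refine Eq.trans ?_ (dyadicMap_quarterEquiv (2 * k + 1) (half k c a) m m' i j).symm
  refine Eq.trans (congrArg₂ ((stationaryEmbedding k).toStarHom a) hsq hsq') ?_
  rw [stationaryEmbedding_apply, half, Matrix.submatrix_apply, hq, hq']
  by_cases h : q.1 = q'.1
  · have : s = s' ↔ m = m' := by
      rw [← hm, ← hm', h, (orbitCode_bijective q'.1).1.eq_iff]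
    simp only [this]
  · rw [ha q q' h]; simp

/-- A matrix on one side may mix its two blocks, but one stage later its four copies are separated
by code, and equal codes lie in one block. Hence the self-adjoint part fills both copies of `F` in
the limit, though it is smaller at each finite stage. -/
theorem exists_half_eq (k : ℕ)
    (x : Fin 2 → Matrix (Fin (2 ^ (2 * k + 1))) (Fin (2 ^ (2 * k + 1))) ℂ) :
    ∃ a : FullMatrix fun _ => 4 ^ (k + 1), IsBlockDiagonal a ∧ ∀ c, half (k + 1) c a =
      dyadicMap (2 * k + 1) (2 * k + 1 + 2) (Nat.le_add_right _ 2) (x c) := by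
  let z := fun c => dyadicMap (2 * k + 1) (2 * k + 1 + 2) (Nat.le_add_right _ 2) (x c)
  refine ⟨Matrix.of fun p q => if (halfCoord (k + 1) p).1 = (halfCoord (k + 1) q).1 then
    z (halfCoord (k + 1) p).1 (halfCoord (k + 1) p).2 (halfCoord (k + 1) q).2 else 0, ?_, ?_⟩
  · intro p q hpq
    obtain ⟨⟨s, p⟩, rfl⟩ := (stationaryEquiv k).surjective p
    obtain ⟨⟨t, q⟩, rfl⟩ := (stationaryEquiv k).surjective q
    rw [stationaryEquiv_fst, stationaryEquiv_fst] at hpq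
    rw [Matrix.of_apply, halfCoord_succ, halfCoord_succ]
    simp only
    split_ifs with h
    · rw [halfCoord_fst, halfCoord_fst] at h
      refine (dyadicMap_quarterEquiv _ _ _ _ _ _).trans (if_neg fun h' => hpq ?_)
      exact symmetry_eq_of_orbitCode_eq _ _ _ _ h h'
    · rfl
  · intro c
    ext i j
    simp [half, z]

/-- The correspondence between `F ⊕ F` and the self-adjoint part of the stationary limit, at a
finite stage. -/
def halfRelation (k : ℕ) : Set ((DyadicMatroid × DyadicMatroid) × DyadicMatroid) :=
  {r | ∃ a : FullMatrix fun _ => 4 ^ k, IsBlockDiagonal a ∧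
    r = ((DyadicMatroid.of (2 * k + 1) (half k 0 a), DyadicMatroid.of (2 * k + 1) (half k 1 a)),
      stationaryRealization.incl k a)}

theorem isStarRelation_halfRelation (k : ℕ) : IsStarRelation (halfRelation k) where
  zero := ⟨0, fun _ _ _ => rfl, by
    have h : ∀ c, half k c 0 = 0 := fun _ => rfl
    rw [h, h, map_zero]
    exact Prod.ext rfl (map_zero (stationaryRealization.incl k)).symm⟩
  add := by
    rintro _ ⟨a, ha, rfl⟩ _ ⟨b, hb, rfl⟩
    refine ⟨a + b, ha.add hb, ?_⟩
    have h : ∀ c, half k c (a + b) = half k c a + half k c b := fun _ => rfl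
    rw [h, h, map_add, map_add]
    exact Prod.ext rfl (map_add (stationaryRealization.incl k) a b).symm
  mul := by
    rintro _ ⟨a, ha, rfl⟩ _ ⟨b, hb, rfl⟩
    refine ⟨a * b, ?_, ?_⟩
    · rw [← mem_fourCycle_and_star_iff] at ha hb ⊢
      rw [star_mul]
      exact ⟨mul_mem ha.1 hb.1, mul_mem hb.2 ha.2⟩
    · rw [half_mul 0 ha, half_mul 1 ha, map_mul, map_mul]
      exact Prod.ext rfl (map_mul (stationaryRealization.incl k) a b).symm
  smul := by
    rintro c _ ⟨a, ha, rfl⟩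
    refine ⟨c • a, fun p q h => by rw [Matrix.smul_apply, ha p q h, smul_zero], ?_⟩
    have h : ∀ d, half k d (c • a) = c • half k d a := fun _ => rfl
    rw [h, h, map_smul, map_smul]
    exact Prod.ext rfl (map_smul (stationaryRealization.incl k) c a).symm
  star := by
    rintro _ ⟨a, ha, rfl⟩
    refine ⟨star a, fun p q h => by rw [Matrix.star_apply, ha q p h.symm, star_zero], ?_⟩
    have h : ∀ c, half k c (star a) = star (half k c a) := fun _ => rfl
    rw [h, h, map_star, map_star]
    exact Prod.ext rfl (map_star (stationaryRealization.incl k) a).symm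

theorem monotone_halfRelation : Monotone halfRelation := by
  refine monotone_nat_of_le_succ fun k => ?_
  rintro _ ⟨a, ha, rfl⟩
  refine ⟨(stationaryEmbedding k).toStarHom a, RigidEmbedding.toStarHom_isBlockDiagonal _ ha, ?_⟩
  rw [half_stationaryEmbedding 0 ha, half_stationaryEmbedding 1 ha]
  refine Prod.ext (Prod.ext ?_ ?_) (stationaryRealization.compatible k a).symm
  · exact (DyadicMatroid.of_dyadicMap _ _).symm
  · exact (DyadicMatroid.of_dyadicMap _ _).symm

/-- The inclusion `F ⊕ F → F` given by the stationary system. -/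
theorem exists_stationary_inclusion :
    ∃ ζ : DyadicMatroid × DyadicMatroid →⋆ₙₐ[ℂ] DyadicMatroid, ζ 1 = 1 ∧ Function.Injective ζ ∧
      Set.range ζ = stationaryRealization.selfAdjointPart := by
  have hcommon : ∀ {r r'}, r ∈ ⋃ k, halfRelation k → r' ∈ ⋃ k, halfRelation k →
      ∃ k, r ∈ halfRelation k ∧ r' ∈ halfRelation k := by
    intro r r' hr hr'
    obtain ⟨i, hi⟩ := Set.mem_iUnion.1 hr
    obtain ⟨j, hj⟩ := Set.mem_iUnion.1 hr'
    exact ⟨max i j, monotone_halfRelation (le_max_left i j) hi,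
      monotone_halfRelation (le_max_right i j) hj⟩
  obtain ⟨ζ, hζ⟩ := (isStarRelation_iUnion monotone_halfRelation
    isStarRelation_halfRelation).exists_starHom (by
      rintro ⟨x, y⟩
      obtain ⟨k, x, y, rfl, rfl⟩ := DyadicMatroid.exists_of₂ x y
      obtain ⟨x', hx'⟩ := DyadicMatroid.exists_of_of_le (show k ≤ 2 * k + 1 by omega) x
      obtain ⟨y', hy'⟩ := DyadicMatroid.exists_of_of_le (show k ≤ 2 * k + 1 by omega) y
      obtain ⟨a, ha, hax⟩ := exists_half_eq k ![x', y']
      refine ⟨stationaryRealization.incl (k + 1) a, Set.mem_iUnion.2 ⟨k + 1, a, ha, ?_⟩⟩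
      rw [hax, hax, ← hx', ← hy']
      refine Prod.ext (Prod.ext ?_ ?_) rfl
      · exact (DyadicMatroid.of_dyadicMap _ _).symm
      · exact (DyadicMatroid.of_dyadicMap _ _).symm) (by
      intro p q q' h h'
      obtain ⟨k, ⟨a, ha, h⟩, ⟨b, hb, h'⟩⟩ := hcommon h h'
      rw [Prod.mk.injEq] at h h'
      have hp := h.1.symm.trans h'.1
      rw [Prod.mk.injEq] at hp
      obtain rfl := eq_of_half_eq ha hb fun c => by
        fin_cases c
        · exact DyadicMatroid.of_injective _ hp.1
        · exact DyadicMatroid.of_injective _ hp.2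
      exact h.2.trans h'.2.symm)
  refine ⟨ζ, ?_, ?_, ?_⟩
  · rw [← hζ]
    refine Set.mem_iUnion.2 ⟨0, 1, isBlockDiagonal_one, ?_⟩
    rw [half_one, half_one, DyadicMatroid.of_one]
    refine Prod.ext rfl (Eq.symm ?_)
    change DyadicMatroid.of (2 * 0 + 2)
      (reindexStarHom (stationaryCoord 0) (1 : FullMatrix fun _ => 4 ^ 0)) = 1
    rw [reindexStarHom_one, DyadicMatroid.of_one]
  · intro p p' h
    obtain ⟨k, ⟨a, ha, h⟩, ⟨b, hb, h'⟩⟩ := hcommon ((hζ p _).2 rfl) ((hζ p' _).2 h.symm)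
    simp only [Prod.mk.injEq] at h h'
    have : a = b := stationaryRealization.injective k (h.2.symm.trans h'.2)
    rw [h.1, h'.1, this]
  · ext b
    rw [RigidSystem.Realization.mem_selfAdjointPart_iff]
    constructor
    · rintro ⟨p, rfl⟩
      obtain ⟨k, a, ha, h⟩ := Set.mem_iUnion.1 ((hζ p _).2 rfl)
      exact ⟨k, a, ha, (congrArg Prod.snd h).symm⟩
    · rintro ⟨k, a, ha, rfl⟩
      exact ⟨_, (hζ _ _).1 (Set.mem_iUnion.2 ⟨k, a, ha, rfl⟩)⟩

end FourCycle

end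

theorem theorem4p4 :
    ∃ ζ : FourCycle.DyadicMatroid × FourCycle.DyadicMatroid →⋆ₙₐ[ℂ] FourCycle.DyadicMatroid,
      ζ 1 = 1 ∧
      FourCycle.IsGivenBy ζ FourCycle.stationarySystem ∧
      Subsingleton FourCycle.stationarySystem.LimitH1 ∧
      FourCycle.IsGenericIndexFour ζ ∧
      FourCycle.HasTrivialHomology ζ ∧
      ∀ π : FourCycle.DyadicMatroid × FourCycle.DyadicMatroid →⋆ₙₐ[ℂ] FourCycle.DyadicMatroid,
        FourCycle.IsGenericIndexFour π → FourCycle.HasTrivialHomology π →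
          FourCycle.SamePosition π ζ := by
  obtain ⟨ζ, h1, hinj, hrange⟩ := FourCycle.exists_stationary_inclusion
  have hgiven : FourCycle.IsGivenBy ζ FourCycle.stationarySystem :=
    ⟨hinj, FourCycle.stationaryRealization, hrange⟩
  have hgen := FourCycle.stationarySystem_isGeneric
  have hH1 : Subsingleton FourCycle.stationarySystem.LimitH1 :=
    (FourCycle.stationarySystem.subsingleton_limitH1_iff).2
      FourCycle.stationarySystem_isDyadic.cycleSign
  refine ⟨ζ, h1, hgiven, hH1, ⟨_, hgen, hgiven⟩, ⟨_, hgen, hgiven, hH1⟩, ?_⟩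
  rintro π - ⟨S, -, hS, hS1⟩
  obtain ⟨K, hK⟩ := FourCycle.RigidSystem.exists_isDyadic hS hS1
  obtain ⟨-, ι, hι⟩ := hS
  obtain ⟨σ, hσ⟩ := FourCycle.exists_starEquiv ι FourCycle.stationaryRealization hK
    FourCycle.stationarySystem_isDyadic
  exact ⟨σ, by rw [hι, hσ, hrange]⟩
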